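/- Let $d\ge 2$ and let $\Sigma=\{(\tau,\xi)\in\mathbb R\times\mathbb R^d:\tau=\langle\xi\rangle\}$, where $\langle\xi\rangle=\sqrt{|\xi|^2+1}$, be equipped with the measure $\mu$ given by $\int_\Sigma f\,d\mu=\int_{\mathbb R^d}f(\langle\xi\rangle,\xi)\,\frac{d\xi}{\langle\xi\rangle}$. For continuous, compactly supported $f:\Sigma\to\mathbb C$ put $$\mathcal Ef(t,x)=\int_\Sigma e^{i(t,x)\cdot(\tau,\xi)}f(\tau,\xi)\,d\mu(\tau,\xi),\qquad (t,x)\in\mathbb R\times\mathbb R^d,$$ and, for $p,q\in[1,\infty]$, let $\mathcal E(p\to q)$ denote the statement that $\mathcal E$ extends to a bounded linear operator from $L^p(\Sigma,\mu)$ to $L^q(\mathbb R\times\mathbb R^d)$. Let $\sigma$ be the surface measure on the unit sphere $\mathbb S^{d-1}\subset\mathbb R^d$, and let $p'$ be the conjugate exponent of $p$, $\frac1p+\frac1{p'}=1$. Proposition. Let $p,q\in[1,\infty]$ satisfy $p'=\frac{d-1}{d+1}q$. If there is a constant $C<\infty$ such that $$\Big\|\int_{\mathbb S^{d-1}}e^{ix\cdot\theta}f(\theta)\,d\sigma(\theta)\Big\|_{L^q(\mathbb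 R^d)}\le C\,\|f\|_{L^p(\mathbb S^{d-1})}\qquad\text{for all } f\in L^p(\mathbb S^{d-1}),$$ then $\mathcal E(p\to q)$ holds. -/

import Mathlib

open MeasureTheory
open scoped ENNReal NNReal

noncomputable section

/-- The Euclidean space `ℝ^d`. -/
abbrev Euc (d : ℕ) : Type := EuclideanSpace ℝ (Fin d)

/-- The Japanese bracket `⟨ξ⟩ = √(|ξ|² + 1)`. -/
def bracket {d : ℕ} (ξ : Euc d) : ℝ := Real.sqrt (‖ξ‖ ^ 2 + 1)

/-- The upper sheet `Σ = {(τ, ξ) ∈ ℝ × ℝ^d : τ = ⟨ξ⟩}` of the elliptic hyperboloid. -/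
def hyperboloid (d : ℕ) : Set (ℝ × Euc d) := {z | z.1 = bracket z.2}

/-- The graph parametrization `ξ ↦ (⟨ξ⟩, ξ)` of `Σ`. -/
def hyperboloidPoint {d : ℕ} (ξ : Euc d) : hyperboloid d := ⟨(bracket ξ, ξ), rfl⟩

/-- The Lorentz-invariant measure `μ` on `Σ`: the push-forward of `dξ / ⟨ξ⟩` under
`ξ ↦ (⟨ξ⟩, ξ)`, so that `∫ f dμ = ∫ f(⟨ξ⟩, ξ) dξ / ⟨ξ⟩`. -/
def lorentzMeasure (d : ℕ) : Measure (hyperboloid d) :=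
  ((volume : Measure (Euc d)).withDensity (fun ξ => ENNReal.ofReal (1 / bracket ξ))).map
    hyperboloidPoint

theorem continuous_bracket {d : ℕ} : Continuous (bracket : Euc d → ℝ) := by
  unfold bracket
  fun_prop

theorem continuous_hyperboloidPoint {d : ℕ} :
    Continuous (hyperboloidPoint : Euc d → hyperboloid d) :=
  Continuous.subtype_mk (continuous_bracket.prodMk continuous_id) _

theorem one_le_bracket {d : ℕ} (ξ : Euc d) : 1 ≤ bracket ξ := by
  unfold bracket
  rw [Real.one_le_sqrt]
  nlinarith [sq_nonneg ‖ξ‖]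

instance instFiniteOnCompactsLorentz (d : ℕ) :
    IsFiniteMeasureOnCompacts (lorentzMeasure d) where
  lt_top_of_isCompact := by
    intro K hK
    have hpre : (hyperboloidPoint : Euc d → hyperboloid d) ⁻¹' K =
        (fun z : hyperboloid d => z.1.2) '' K := by
      ext ξ
      constructor
      · intro h
        exact ⟨hyperboloidPoint ξ, h, rfl⟩
      · rintro ⟨⟨⟨τ, η⟩, hz⟩, hzK, rfl⟩
        have hz' : τ = bracket η := hz
        subst hz'
        exact hzK
    have hcomp : IsCompact ((hyperboloidPoint : Euc d → hyperboloid d) ⁻¹' K) := by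
      rw [hpre]
      exact hK.image (continuous_snd.comp continuous_subtype_val)
    unfold lorentzMeasure
    rw [Measure.map_apply continuous_hyperboloidPoint.measurable hK.measurableSet,
      withDensity_apply _ hcomp.measurableSet]
    refine lt_of_le_of_lt (lintegral_mono (g := fun _ => 1) ?_) ?_
    · intro ξ
      have h1 := one_le_bracket ξ
      exact ENNReal.ofReal_le_one.2 ((div_le_one (by linarith)).2 h1)
    · simpa using hcomp.measure_lt_top

/-- A continuous compactly supported function on `Σ` belongs to `L^p(Σ, μ)`. -/
theorem memLp_hyperboloid {d : ℕ} (p : ℝ≥0∞) (f : hyperboloid d → ℂ)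
    (hf : Continuous f) (hc : HasCompactSupport f) : MemLp f p (lorentzMeasure d) :=
  hf.memLp_of_hasCompactSupport hc

/-- The extension operator of `Σ`:
`ℰ f(t, x) = ∫_Σ e^{i (t, x) · (τ, ξ)} f(τ, ξ) dμ(τ, ξ)`. -/
def hyperboloidExtension {d : ℕ} (f : hyperboloid d → ℂ) (y : ℝ × Euc d) : ℂ :=
  ∫ z : hyperboloid d,
    Complex.exp (Complex.I * ((y.1 * z.1.1 + inner ℝ y.2 z.1.2 : ℝ) : ℂ)) * f z
      ∂(lorentzMeasure d)

/-- The statement `ℰ(p → q)`: the operator `ℰ`, given by its integral on continuous compactly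
supported functions, extends to a bounded linear operator from `L^p(Σ, μ)` to
`L^q(ℝ × ℝ^d)`. -/
def HyperboloidExtensionBounded (d : ℕ) (p q : ℝ≥0∞) [Fact (1 ≤ p)] [Fact (1 ≤ q)] : Prop :=
  ∃ T : Lp ℂ p (lorentzMeasure d) →L[ℂ] Lp ℂ q (volume : Measure (ℝ × Euc d)),
    ∀ (f : hyperboloid d → ℂ) (hf : Continuous f) (hc : HasCompactSupport f),
      T ((memLp_hyperboloid p f hf hc).toLp f) =ᵐ[volume] hyperboloidExtension f

/-- The surface measure `σ` on the unit sphere `𝕊^{d-1}` of `ℝ^d`. -/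
def sphereMeasure (d : ℕ) : Measure (Metric.sphere (0 : Euc d) 1) :=
  (volume : Measure (Euc d)).toSphere

/-- The extension operator of the unit sphere: `x ↦ ∫_{𝕊^{d-1}} e^{i x · θ} f(θ) dσ(θ)`. -/
def sphereExtension {d : ℕ} (f : Metric.sphere (0 : Euc d) 1 → ℂ) (x : Euc d) : ℂ :=
  ∫ θ : Metric.sphere (0 : Euc d) 1,
    Complex.exp (Complex.I * ((inner ℝ x (θ : Euc d) : ℝ) : ℂ)) * f θ ∂(sphereMeasure d)

/-- The extension operator of the unit sphere is bounded from `L^p(𝕊^{d-1})` to `L^q(ℝ^d)`. -/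
def SphereExtensionBounded (d : ℕ) (p q : ℝ≥0∞) : Prop :=
  ∃ C : ℝ≥0, ∀ f : Metric.sphere (0 : Euc d) 1 → ℂ, MemLp f p (sphereMeasure d) →
    eLpNorm (sphereExtension f) q volume ≤ C * eLpNorm f p (sphereMeasure d)

end

noncomputable section

open Set

/-! In polar coordinates `ℰ f(t, x)` is, for fixed `x`, the one-dimensional oscillatory integral in
`t` with phase `t√(r² + 1)` of the slice `k_x(r) = r^(d-2) · (sphere extension of F(r·))(r x)`,
taken against `dν = r dr / √(r² + 1)`. Under `τ = √(r² + 1)` the measure `ν` becomes Lebesgue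
measure on `(1, ∞)`, so this operator is a Fourier transform: it is of type `(1, ∞)` and, by
Plancherel, of type `(2, 2)`.

Paley's inequality (`paley_inequality`) then gives `∫ |ℰ f(t, x)|^q dt ≲ ∫ |k_x|^q ψ^(q-2) dν` for
every positive weight with `ν{ψ ≤ s} ≲ s`. The weight may depend on `f` as long as it does not
depend on `x`. The `x`-integral can therefore be moved inside, where the sphere estimate and scaling
(`lintegral_radialSlice_rpow_le`) give `∫ |k_x(r)|^q dx ≲ r^(-κ) B(r)^(q/p)`, with `κ = 2/(d-1)` and
`B(r)` the `L^p` mass of `f` on the sphere of radius `r`.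

Put `N = ∫ B dν = ‖f‖_p^p` and `ψ = r^α (N/B)^(1-α)` with `α = κ/(q-2)`. The exponent relation gives
`q/p = q - 1 - κ`, hence `ψ^(q-2) = r^κ (N/B)^(q/p-1)`. The powers of `r` cancel, the integrand
becomes `N^(q/p-1) B`, and its integral is `N^(q/p)`. The weight is admissible
(`measure_mixedWeight_le`) because a geometric mean is at least the smaller of its two factors.

This needs `α ≤ 1`, that is `q ≥ 2d/(d-1)`, which is a necessary condition for the sphere estimate
(`SphereExtensionBounded.le_exponent`). The case `q = ∞`, `p = 1` is trivial, and density of `C_c`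
in `L^p` turns the a priori bound into a bounded operator. -/

theorem setLIntegral_Ioi_rpow {a c : ℝ} (ha : a < -1) (hc : 0 < c) :
    ∫⁻ t in Ioi c, ENNReal.ofReal (t ^ a) = ENNReal.ofReal (-c ^ (a + 1) / (a + 1)) := by
  rw [← integral_Ioi_rpow_of_lt ha hc, ofReal_integral_eq_lintegral_ofReal
    (integrableOn_Ioi_rpow_of_lt ha hc)]
  filter_upwards [ae_restrict_mem measurableSet_Ioi] with t ht
  exact Real.rpow_nonneg (hc.trans ht).le _

theorem setLIntegral_Ioc_rpow {a c : ℝ} (ha : -1 < a) (hc : 0 ≤ c) :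
    ∫⁻ t in Ioc 0 c, ENNReal.ofReal (t ^ a) = ENNReal.ofReal (c ^ (a + 1) / (a + 1)) := by
  have h := integral_rpow (a := 0) (b := c) (Or.inl ha)
  rw [Real.zero_rpow (by linarith), sub_zero, intervalIntegral.integral_of_le hc] at h
  rw [← h, ofReal_integral_eq_lintegral_ofReal]
  · exact (intervalIntegrable_iff_integrableOn_Ioc_of_le hc).1
      (intervalIntegral.intervalIntegrable_rpow' ha)
  filter_upwards [ae_restrict_mem measurableSet_Ioc] with t ht
  exact Real.rpow_nonneg ht.1.le _

/-! ### Power integrals of a weight with linearly growing sublevel sets. -/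

section Weights

variable {X : Type*} [MeasurableSpace X] {ν : Measure X} {ψ : X → ℝ} {K : ℝ≥0∞}

/-- Layer cake for `1/ψ`: at heights `t ≤ 1/s` the superlevel set is bounded by the whole domain, of
mass `K s`, and at heights `t > 1/s` by `K/t`. The condition `β < 1` makes the tail converge. -/
theorem setLIntegral_weight_rpow_le_of_lt_one (hψm : Measurable ψ) (hψ : ∀ x, 0 < ψ x)
    (hK : ∀ s : ℝ, 0 < s → ν {x | ψ x ≤ s} ≤ K * ENNReal.ofReal s)
    {β : ℝ} (hβ : 0 < β) (hβ1 : β < 1) {s : ℝ} (hs : 0 < s) :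
    ∫⁻ x in {x | ψ x ≤ s}, ENNReal.ofReal (ψ x ^ (-β)) ∂ν ≤
      K * ENNReal.ofReal (s ^ (1 - β) / (1 - β)) := by
  have hs' : 0 < s⁻¹ := inv_pos.2 hs
  have e1 : ∀ x, ψ x ^ (-β) = ((ψ x)⁻¹) ^ β := fun x => by
    rw [Real.rpow_neg (hψ x).le, Real.inv_rpow (hψ x).le]
  simp_rw [e1]
  rw [lintegral_rpow_eq_lintegral_meas_lt_mul _
    (Filter.Eventually.of_forall fun x => (inv_pos.2 (hψ x)).le) hψm.inv.aemeasurable hβ,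
    ← Ioc_union_Ioi_eq_Ioi hs'.le, lintegral_union measurableSet_Ioi
      (Ioc_disjoint_Ioi le_rfl)]
  have b1 : ∫⁻ t in Ioc 0 s⁻¹, (ν.restrict {x | ψ x ≤ s}) {a | t < (ψ a)⁻¹} *
      ENNReal.ofReal (t ^ (β - 1)) ≤ K * ENNReal.ofReal (s * (s⁻¹ ^ β / β)) := by
    calc _ ≤ ∫⁻ t in Ioc 0 s⁻¹, (K * ENNReal.ofReal s) * ENNReal.ofReal (t ^ (β - 1)) := by
          refine lintegral_mono fun t => ?_
          gcongr
          refine le_trans (measure_mono (subset_univ _)) ?_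
          rw [Measure.restrict_apply_univ]
          exact hK s hs
      _ = _ := by
          rw [lintegral_const_mul _ (by fun_prop), setLIntegral_Ioc_rpow (by linarith) hs'.le,
            mul_assoc, ← ENNReal.ofReal_mul hs.le, sub_add_cancel]
  have b2 : ∫⁻ t in Ioi s⁻¹, (ν.restrict {x | ψ x ≤ s}) {a | t < (ψ a)⁻¹} *
      ENNReal.ofReal (t ^ (β - 1)) ≤ K * ENNReal.ofReal (s⁻¹ ^ (β - 1) / (1 - β)) := by
    calc _ ≤ ∫⁻ t in Ioi s⁻¹, K * ENNReal.ofReal (t ^ (β - 2)) := by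
          refine setLIntegral_mono (by fun_prop) fun t ht => ?_
          have ht0 : 0 < t := hs'.trans ht
          have : (ν.restrict {x | ψ x ≤ s}) {a | t < (ψ a)⁻¹} ≤ K * ENNReal.ofReal t⁻¹ := by
            refine le_trans (Measure.restrict_apply_le _ _) (le_trans (measure_mono ?_)
              (hK t⁻¹ (inv_pos.2 ht0)))
            intro x hx
            exact (lt_inv_comm₀ ht0 (hψ x)).1 hx |>.le
          refine (mul_le_mul_left this _).trans ?_
          rw [mul_assoc, ← ENNReal.ofReal_mul (inv_pos.2 ht0).le]
          gcongr
          rw [← Real.rpow_neg_one, ← Real.rpow_add ht0]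
          exact le_of_eq (by ring_nf)
      _ = _ := by
          rw [lintegral_const_mul _ (by fun_prop), setLIntegral_Ioi_rpow (by linarith) hs']
          congr 2
          rw [show β - 2 + 1 = -(1 - β) by ring, neg_div_neg_eq]
          congr 2; ring
  refine (mul_le_mul_right (add_le_add b1 b2) _).trans ?_
  rw [← mul_add, mul_left_comm, ← ENNReal.ofReal_add (by positivity)
    (div_nonneg (by positivity) (by linarith)), ← ENNReal.ofReal_mul hβ.le]
  gcongr
  apply le_of_eq
  have e2 : s⁻¹ ^ β = s ^ (-β) := by rw [Real.rpow_neg hs.le, Real.inv_rpow hs.le]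
  have e3 : s⁻¹ ^ (β - 1) = s * s ^ (-β) := by
    rw [Real.inv_rpow hs.le, ← Real.rpow_neg hs.le]
    nth_rw 2 [← Real.rpow_one s]
    rw [← Real.rpow_add hs]; ring_nf
  have e4 : s ^ (1 - β) = s * s ^ (-β) := by
    nth_rw 2 [← Real.rpow_one s]
    rw [← Real.rpow_add hs]; ring_nf
  rw [e2, e3, e4]
  have : 1 - β ≠ 0 := by linarith
  field_simp
  ring

/-- On this domain `1/ψ ≤ 1/s`, so only heights `t ≤ 1/s` contribute to the layer cake; `γ > 1`
gives convergence at `t = 0`. -/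
theorem setLIntegral_weight_rpow_le_of_one_lt (hψm : Measurable ψ) (hψ : ∀ x, 0 < ψ x)
    (hK : ∀ s : ℝ, 0 < s → ν {x | ψ x ≤ s} ≤ K * ENNReal.ofReal s)
    {γ : ℝ} (hγ : 1 < γ) {s : ℝ} (hs : 0 < s) :
    ∫⁻ x in {x | s ≤ ψ x}, ENNReal.ofReal (ψ x ^ (-γ)) ∂ν ≤
      K * ENNReal.ofReal (γ / (γ - 1) * s ^ (1 - γ)) := by
  have hs' : 0 < s⁻¹ := inv_pos.2 hs
  have e1 : ∀ x, ψ x ^ (-γ) = ((ψ x)⁻¹) ^ γ := fun x => by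
    rw [Real.rpow_neg (hψ x).le, Real.inv_rpow (hψ x).le]
  simp_rw [e1]
  rw [lintegral_rpow_eq_lintegral_meas_lt_mul _
    (Filter.Eventually.of_forall fun x => (inv_pos.2 (hψ x)).le) hψm.inv.aemeasurable (by linarith),
    ← Ioc_union_Ioi_eq_Ioi hs'.le, lintegral_union measurableSet_Ioi
      (Ioc_disjoint_Ioi le_rfl)]
  have b1 : ∫⁻ t in Ioc 0 s⁻¹, (ν.restrict {x | s ≤ ψ x}) {a | t < (ψ a)⁻¹} *
      ENNReal.ofReal (t ^ (γ - 1)) ≤ K * ENNReal.ofReal (s⁻¹ ^ (γ - 1) / (γ - 1)) := by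
    calc _ ≤ ∫⁻ t in Ioc 0 s⁻¹, K * ENNReal.ofReal (t ^ (γ - 2)) := by
          refine setLIntegral_mono (by fun_prop) fun t ht => ?_
          have ht0 : 0 < t := ht.1
          have : (ν.restrict {x | s ≤ ψ x}) {a | t < (ψ a)⁻¹} ≤ K * ENNReal.ofReal t⁻¹ := by
            refine le_trans (Measure.restrict_apply_le _ _) (le_trans (measure_mono ?_)
              (hK t⁻¹ (inv_pos.2 ht0)))
            intro x hx
            exact (lt_inv_comm₀ ht0 (hψ x)).1 hx |>.le
          refine (mul_le_mul_left this _).trans ?_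
          rw [mul_assoc, ← ENNReal.ofReal_mul (inv_pos.2 ht0).le]
          gcongr
          rw [← Real.rpow_neg_one, ← Real.rpow_add ht0]
          exact le_of_eq (by ring_nf)
      _ = _ := by
          rw [lintegral_const_mul _ (by fun_prop), setLIntegral_Ioc_rpow (by linarith) hs'.le]
          rw [show γ - 2 + 1 = γ - 1 by ring]
  have b2 : ∫⁻ t in Ioi s⁻¹, (ν.restrict {x | s ≤ ψ x}) {a | t < (ψ a)⁻¹} *
      ENNReal.ofReal (t ^ (γ - 1)) = 0 := by
    rw [setLIntegral_congr_fun (g := fun _ => 0) measurableSet_Ioi, lintegral_zero]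
    intro t ht
    have ht0 : 0 < t := hs'.trans ht
    have : (ν.restrict {x | s ≤ ψ x}) {a | t < (ψ a)⁻¹} = 0 := by
      have hm : MeasurableSet {a | t < (ψ a)⁻¹} := measurableSet_lt measurable_const hψm.inv
      rw [Measure.restrict_apply hm]
      convert measure_empty (μ := ν)
      ext x
      simp only [mem_inter_iff, mem_ofPred_eq, mem_empty_iff_false, iff_false, not_and, not_le]
      intro hx
      exact ((lt_inv_comm₀ ht0 (hψ x)).1 hx).trans ((inv_lt_comm₀ hs ht0).1 ht)
    simp only [this, zero_mul]
  rw [b2, add_zero]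
  refine (mul_le_mul_right b1 _).trans ?_
  rw [mul_left_comm, ← ENNReal.ofReal_mul (by linarith)]
  refine mul_le_mul_right (ENNReal.ofReal_le_ofReal (le_of_eq ?_)) _
  have e2 : s⁻¹ ^ (γ - 1) = s ^ (1 - γ) := by
    rw [Real.inv_rpow hs.le, ← Real.rpow_neg hs.le]; ring_nf
  rw [e2]; ring

end Weights

/-! ### Hardy's inequality along the sublevel sets of a weight. -/

section Hardy

variable {X : Type*} [MeasurableSpace X] {ν : Measure X} {ψ : X → ℝ} {K : ℝ≥0∞}

/-- The integral of `f` over the sublevel set of `ψ` through `x`. -/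
def sublevelIntegral (ν : Measure X) (ψ : X → ℝ) (f : X → ℝ≥0∞) (x : X) : ℝ≥0∞ :=
  ∫⁻ y in {y | ψ y ≤ ψ x}, f y ∂ν

theorem measurable_sublevelIntegral (hψm : Measurable ψ) (f : X → ℝ≥0∞) :
    Measurable (sublevelIntegral ν ψ f) := by
  have hmono : Monotone fun s : ℝ => ∫⁻ y in {y | ψ y ≤ s}, f y ∂ν := fun s t hst =>
    lintegral_mono_set fun y (hy : ψ y ≤ s) => hy.trans hst
  exact hmono.measurable.comp hψm

/-- Hölder applied to `f = (f ψ^e) · ψ^(-e)`, where the second factor is controlled by the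
integrability of `ψ^(-β)` near `ψ = 0`. -/
theorem sublevelIntegral_rpow_le (hψm : Measurable ψ) (hψ : ∀ x, 0 < ψ x)
    (hK : ∀ s : ℝ, 0 < s → ν {x | ψ x ≤ s} ≤ K * ENNReal.ofReal s)
    {f : X → ℝ≥0∞} (hf : Measurable f) {q : ℝ} (hq : 2 < q) (x : X) :
    sublevelIntegral ν ψ f x ^ q ≤
      (∫⁻ y in {y | ψ y ≤ ψ x}, f y ^ q * ENNReal.ofReal (ψ y ^ (q - 3 / 2)) ∂ν) *
        ((K * ENNReal.ofReal (2 * (q - 1))) ^ (q - 1) * ENNReal.ofReal (ψ x ^ (1 / 2 : ℝ))) := by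
  -- This `β` gives `(1 - β)(q - 1) = 1/2`. The gain `ψ^(1/2)` is small enough that, multiplied
  -- later by `ψ^(-2)`, it leaves `ψ^(-3/2)`, still integrable where `ψ` is large.
  set β : ℝ := 1 - 1 / (2 * (q - 1)) with hβdef
  have hq1 : 0 < q - 1 := by linarith
  have hδ : 1 / (2 * (q - 1)) < 1 := by rw [div_lt_one (by linarith)]; linarith
  have hδ0 : 0 < 1 / (2 * (q - 1)) := by positivity
  have hβ0 : 0 < β := by linarith
  have hβ1 : β < 1 := by linarith
  have hβq : β * (q - 1) = q - 3 / 2 := by rw [hβdef]; field_simp; ring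
  have hconj : q.HolderConjugate (q / (q - 1)) := Real.HolderConjugate.conjExponent (by linarith)
  set e : ℝ := β * (q - 1) / q with he
  have hsplit : ∀ y, f y = ((fun y => f y * ENNReal.ofReal (ψ y ^ e)) *
      (fun y => ENNReal.ofReal (ψ y ^ (-e)))) y := fun y => by
    simp only [Pi.mul_apply]
    rw [mul_assoc, ← ENNReal.ofReal_mul (Real.rpow_nonneg (hψ y).le _), ← Real.rpow_add (hψ y)]
    simp
  have hH := ENNReal.lintegral_mul_le_Lp_mul_Lq (ν.restrict {y | ψ y ≤ ψ x}) hconj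
    (f := fun y => f y * ENNReal.ofReal (ψ y ^ e)) (g := fun y => ENNReal.ofReal (ψ y ^ (-e)))
    (by fun_prop) (by fun_prop)
  simp_rw [← hsplit] at hH
  have h1 : ∀ y, (f y * ENNReal.ofReal (ψ y ^ e)) ^ q =
      f y ^ q * ENNReal.ofReal (ψ y ^ (q - 3 / 2)) := fun y => by
    rw [ENNReal.mul_rpow_of_nonneg _ _ (by linarith), ENNReal.ofReal_rpow_of_nonneg
      (Real.rpow_nonneg (hψ y).le _) (by linarith), ← Real.rpow_mul (hψ y).le, ← hβq, he,
      div_mul_cancel₀ _ (by linarith)]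
  have h2 : ∀ y, ENNReal.ofReal (ψ y ^ (-e)) ^ (q / (q - 1)) =
      ENNReal.ofReal (ψ y ^ (-β)) := fun y => by
    rw [ENNReal.ofReal_rpow_of_nonneg (Real.rpow_nonneg (hψ y).le _) (by positivity),
      ← Real.rpow_mul (hψ y).le, he]
    congr 2
    field_simp
  simp_rw [h1, h2] at hH
  have hH2 := ENNReal.rpow_le_rpow hH (show (0 : ℝ) ≤ q by linarith)
  rw [ENNReal.mul_rpow_of_nonneg _ _ (by linarith), ← ENNReal.rpow_mul, ← ENNReal.rpow_mul,
    one_div_mul_cancel (by linarith), ENNReal.rpow_one,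
    show 1 / (q / (q - 1)) * q = q - 1 by field_simp] at hH2
  refine hH2.trans (mul_le_mul_right ?_ _)
  have h3 := setLIntegral_weight_rpow_le_of_lt_one hψm hψ hK hβ0 hβ1 (hψ x)
  refine (ENNReal.rpow_le_rpow h3 hq1.le).trans (le_of_eq ?_)
  have h4 : ψ x ^ (1 - β) / (1 - β) = (2 * (q - 1)) * ψ x ^ (1 / (2 * (q - 1))) := by
    rw [show 1 - β = 1 / (2 * (q - 1)) by rw [hβdef]; ring]
    field_simp
  rw [h4, ENNReal.ofReal_mul (by linarith), ← mul_assoc, ENNReal.mul_rpow_of_nonneg _ _ hq1.le,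
    ENNReal.ofReal_rpow_of_nonneg (Real.rpow_nonneg (hψ x).le _) hq1.le,
    ← Real.rpow_mul (hψ x).le]
  congr 3
  field_simp

/-- Hardy's inequality with `ψ` in the role of the half-line variable. After the pointwise Hölder
bound, Tonelli leaves `∫_{ψ x ≥ ψ y} ψ^(-3/2) dν ≤ 3 K ψ(y)^(-1/2)`. -/
theorem lintegral_sublevelIntegral_rpow_le [SFinite ν] (hψm : Measurable ψ) (hψ : ∀ x, 0 < ψ x)
    (hK : ∀ s : ℝ, 0 < s → ν {x | ψ x ≤ s} ≤ K * ENNReal.ofReal s)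
    {f : X → ℝ≥0∞} (hf : Measurable f) {q : ℝ} (hq : 2 < q) :
    ∫⁻ x, sublevelIntegral ν ψ f x ^ q * ENNReal.ofReal (ψ x ^ (-2 : ℝ)) ∂ν ≤
      ((K * ENNReal.ofReal (2 * (q - 1))) ^ (q - 1) * (3 * K)) *
        ∫⁻ x, f x ^ q * ENNReal.ofReal (ψ x ^ (q - 2)) ∂ν := by
  set C := (K * ENNReal.ofReal (2 * (q - 1))) ^ (q - 1)
  set F : X → ℝ≥0∞ := fun y => f y ^ q * ENNReal.ofReal (ψ y ^ (q - 3 / 2)) with hF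
  have hFm : Measurable F := by fun_prop
  have hms : MeasurableSet {z : X × X | ψ z.2 ≤ ψ z.1} :=
    measurableSet_le (hψm.comp measurable_snd) (hψm.comp measurable_fst)
  have hA : ∀ x, MeasurableSet {y | ψ y ≤ ψ x} := fun x => measurableSet_le hψm measurable_const
  have hB : ∀ y, MeasurableSet {x | ψ y ≤ ψ x} := fun x => measurableSet_le measurable_const hψm
  calc _ ≤ ∫⁻ x, C * ∫⁻ y, {z : X × X | ψ z.2 ≤ ψ z.1}.indicator
            (fun z => F z.2 * ENNReal.ofReal (ψ z.1 ^ (-(3 / 2) : ℝ))) (x, y) ∂ν ∂ν := by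
        refine lintegral_mono fun x => ?_
        refine (mul_le_mul_left (sublevelIntegral_rpow_le hψm hψ hK hf hq x) _).trans
          (le_of_eq ?_)
        have : ∀ y, {z : X × X | ψ z.2 ≤ ψ z.1}.indicator
            (fun z => F z.2 * ENNReal.ofReal (ψ z.1 ^ (-(3 / 2) : ℝ))) (x, y) =
            {y | ψ y ≤ ψ x}.indicator F y * ENNReal.ofReal (ψ x ^ (-(3 / 2) : ℝ)) := fun y => by
          by_cases h : ψ y ≤ ψ x <;> simp [indicator, h]
        simp_rw [this]
        rw [lintegral_mul_const _ (hFm.indicator (hA x)), lintegral_indicator (hA x),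
          mul_assoc, mul_assoc, ← ENNReal.ofReal_mul (Real.rpow_nonneg (hψ x).le _),
          ← Real.rpow_add (hψ x), mul_left_comm, show (1 / 2 : ℝ) + -2 = -(3 / 2) by norm_num]
    _ = C * ∫⁻ y, F y * ∫⁻ x in {x | ψ y ≤ ψ x}, ENNReal.ofReal (ψ x ^ (-(3 / 2) : ℝ)) ∂ν ∂ν := by
        have hm : Measurable ({z : X × X | ψ z.2 ≤ ψ z.1}.indicator
            (fun z => F z.2 * ENNReal.ofReal (ψ z.1 ^ (-(3 / 2) : ℝ)))) := by
          refine Measurable.indicator ?_ hms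
          fun_prop
        rw [lintegral_const_mul _ hm.lintegral_prod_right', lintegral_lintegral_swap
          (f := fun x y => {z : X × X | ψ z.2 ≤ ψ z.1}.indicator
            (fun z => F z.2 * ENNReal.ofReal (ψ z.1 ^ (-(3 / 2) : ℝ))) (x, y)) hm.aemeasurable]
        congr 1
        refine lintegral_congr fun y => ?_
        rw [← lintegral_indicator (hB y), ← lintegral_const_mul _
          (Measurable.indicator (by fun_prop) (hB y))]
        refine lintegral_congr fun x => ?_
        by_cases h : ψ y ≤ ψ x <;> simp [indicator, h]
    _ ≤ C * ∫⁻ y, (3 * K) * (f y ^ q * ENNReal.ofReal (ψ y ^ (q - 2))) ∂ν := by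
        refine mul_le_mul_right (lintegral_mono fun y => ?_) _
        refine (mul_le_mul_right (setLIntegral_weight_rpow_le_of_one_lt hψm hψ hK
          (show (1 : ℝ) < 3 / 2 by norm_num) (hψ y)) _).trans (le_of_eq ?_)
        rw [hF, show (3 / 2 : ℝ) / (3 / 2 - 1) = 3 by norm_num,
          ENNReal.ofReal_mul (by norm_num), show ENNReal.ofReal 3 = 3 by simp]
        rw [show f y ^ q * ENNReal.ofReal (ψ y ^ (q - 3 / 2)) * (K * (3 *
          ENNReal.ofReal (ψ y ^ (1 - 3 / 2 : ℝ)))) = (3 * K) * (f y ^ q *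
          (ENNReal.ofReal (ψ y ^ (q - 3 / 2)) * ENNReal.ofReal (ψ y ^ (1 - 3 / 2 : ℝ)))) by ring,
          ← ENNReal.ofReal_mul (Real.rpow_nonneg (hψ y).le _), ← Real.rpow_add (hψ y)]
        ring_nf
    _ = _ := by rw [lintegral_const_mul _ (by fun_prop)]; ring

/-- With `H` the sublevel integral, `f² H^(q-2) ≤ f^q ψ^(q-2) + H^q ψ^(-2)` pointwise, according to
whether `H ≤ f ψ` or not; Hardy's inequality absorbs the last term. -/
theorem lintegral_sq_mul_sublevelIntegral_rpow_le [SFinite ν] (hψm : Measurable ψ)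
    (hψ : ∀ x, 0 < ψ x) (hK : ∀ s : ℝ, 0 < s → ν {x | ψ x ≤ s} ≤ K * ENNReal.ofReal s)
    {f : X → ℝ≥0∞} (hf : Measurable f) {q : ℝ} (hq : 2 < q) :
    ∫⁻ x, f x ^ (2 : ℝ) * sublevelIntegral ν ψ f x ^ (q - 2) ∂ν ≤
      (1 + (K * ENNReal.ofReal (2 * (q - 1))) ^ (q - 1) * (3 * K)) *
        ∫⁻ x, f x ^ q * ENNReal.ofReal (ψ x ^ (q - 2)) ∂ν := by
  rw [add_mul, one_mul]
  refine le_trans ?_ (add_le_add_right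
    (lintegral_sublevelIntegral_rpow_le hψm hψ hK hf hq) _)
  rw [← lintegral_add_left (by fun_prop)]
  refine lintegral_mono fun x => ?_
  set H := sublevelIntegral ν ψ f x
  set w := ENNReal.ofReal (ψ x) with hw
  have hw0 : w ≠ 0 := (ENNReal.ofReal_pos.2 (hψ x)).ne'
  have hwt : w ≠ ⊤ := ENNReal.ofReal_ne_top
  simp only [← ENNReal.ofReal_rpow_of_pos (hψ x), ← hw]
  rcases le_total H (f x * w) with h | h
  · refine le_trans ?_ le_self_add
    calc _ ≤ f x ^ (2 : ℝ) * (f x * w) ^ (q - 2) := by gcongr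
      _ = _ := by
        rw [ENNReal.mul_rpow_of_nonneg _ _ (by linarith), ← mul_assoc,
          ← ENNReal.rpow_add_of_nonneg _ _ (by norm_num) (by linarith)]
        ring_nf
  · refine le_trans ?_ le_add_self
    have h' : f x ≤ H * w⁻¹ := by
      rw [← div_eq_mul_inv]; exact (ENNReal.le_div_iff_mul_le (Or.inl hw0) (Or.inl hwt)).2 h
    calc _ ≤ (H * w⁻¹) ^ (2 : ℝ) * H ^ (q - 2) := by gcongr
      _ = _ := by
        rw [ENNReal.mul_rpow_of_nonneg _ _ (by norm_num), mul_right_comm,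
          ← ENNReal.rpow_add_of_nonneg _ _ (by norm_num) (by linarith), ENNReal.inv_rpow,
          ← ENNReal.rpow_neg]
        ring_nf

/-- A sublevel set of the sublevel integral carries little mass. -/
theorem setLIntegral_sublevelIntegral_le (hψm : Measurable ψ) {f : X → ℝ≥0∞}
    (hfin : ∫⁻ x, f x ∂ν ≠ ⊤) (c : ℝ≥0∞) :
    ∫⁻ x in {x | sublevelIntegral ν ψ f x ≤ c}, f x ∂ν ≤ c := by
  set η : Measure X := ν.withDensity f
  set G : ℝ → ℝ≥0∞ := fun s => ∫⁻ y in {y | ψ y ≤ s}, f y ∂ν with hG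
  have hmono : Monotone G := fun s t hst =>
    lintegral_mono_set fun y (hy : ψ y ≤ s) => hy.trans hst
  have hJ : MeasurableSet {s | G s ≤ c} := measurableSet_le hmono.measurable measurable_const
  have hpre : {x | sublevelIntegral ν ψ f x ≤ c} = ψ ⁻¹' {s | G s ≤ c} := rfl
  have : IsFiniteMeasure η := isFiniteMeasure_withDensity hfin
  -- The set `{G ≤ c}` is a lower set of reals that may or may not contain its supremum. Inner
  -- regularity treats both cases: a compact subset contains its own maximum, and the mass up to
  -- that maximum is at most `c`.
  rw [hpre, ← withDensity_apply _ (hψm hJ), ← Measure.map_apply hψm hJ,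
    hJ.measure_eq_iSup_isCompact]
  refine iSup₂_le fun Q hQ => iSup_le fun hQc => ?_
  rcases Q.eq_empty_or_nonempty with rfl | hne
  · simp
  have hmem := hQc.sSup_mem hne
  calc (η.map ψ) Q ≤ (η.map ψ) (Iic (sSup Q)) :=
        measure_mono fun s hs => le_csSup hQc.bddAbove hs
    _ = G (sSup Q) := by
        rw [Measure.map_apply hψm measurableSet_Iic, withDensity_apply _ (hψm measurableSet_Iic)]
        rfl
    _ ≤ c := hQ hmem

end Hardy

/-! ### Paley's inequality by real interpolation. -/

section Paley

variable {X Y : Type*} [MeasurableSpace X] [MeasurableSpace Y] {ν : Measure X} {π : Measure Y}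
  {ψ : X → ℝ} {K M : ℝ≥0∞} {T : (X → ℂ) → Y → ℂ}

/-- Split `k` according to its sublevel integral `H`. The part where `H ≤ t/2` has `L¹` norm at most
`t/2`, so its image never exceeds `t/2`. Where `|T k| > t` the other part must therefore contribute
at least `t/2`, and Chebyshev with the `L²` bound applies. -/
theorem measure_lt_norm_le_of_add
    (hadd : ∀ k l, Integrable k ν → Integrable l ν → ∀ y, T (k + l) y = T k y + T l y)
    (hmeas : ∀ k, Integrable k ν → AEStronglyMeasurable (T k) π)
    (h1 : ∀ k, Integrable k ν → ∀ y, ‖T k y‖ₑ ≤ ∫⁻ x, ‖k x‖ₑ ∂ν)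
    (h2 : ∀ k, Integrable k ν → MemLp k 2 ν →
      ∫⁻ y, ‖T k y‖ₑ ^ (2 : ℝ) ∂π ≤ M * ∫⁻ x, ‖k x‖ₑ ^ (2 : ℝ) ∂ν)
    (hψm : Measurable ψ) {k : X → ℂ} (hk1 : Integrable k ν)
    (hk2 : MemLp k 2 ν) {t : ℝ} (ht : 0 < t) :
    π {y | t < ‖T k y‖} ≤ ENNReal.ofReal (4 * t ^ (-2 : ℝ)) *
      (M * ∫⁻ x in {x | ENNReal.ofReal (t / 2) < sublevelIntegral ν ψ (fun x => ‖k x‖ₑ) x},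
        ‖k x‖ₑ ^ (2 : ℝ) ∂ν) := by
  set H := sublevelIntegral ν ψ (fun x => ‖k x‖ₑ) with hH
  have hHm : Measurable H := measurable_sublevelIntegral hψm _
  set L : Set X := {x | ENNReal.ofReal (t / 2) < H x} with hL
  have hLm : MeasurableSet L := measurableSet_lt measurable_const hHm
  have hLc : Lᶜ = {x | H x ≤ ENNReal.ofReal (t / 2)} := by ext; simp [hL]
  have hsmall : ∀ y, ‖T (Lᶜ.indicator k) y‖ₑ ≤ ENNReal.ofReal (t / 2) := fun y => by
    refine (h1 _ (hk1.indicator hLm.compl) y).trans ?_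
    have : ∀ x, ‖Lᶜ.indicator k x‖ₑ = Lᶜ.indicator (fun x => ‖k x‖ₑ) x := fun x => by
      rw [enorm_indicator_eq_indicator_enorm]
    simp_rw [this]
    rw [lintegral_indicator hLm.compl, hLc]
    exact setLIntegral_sublevelIntegral_le hψm hk1.2.ne _
  have hsub : {y | t < ‖T k y‖} ⊆
      {y | ENNReal.ofReal (t / 2) ^ (2 : ℝ) ≤ ‖T (L.indicator k) y‖ₑ ^ (2 : ℝ)} := by
    intro y hy
    have hsum : T k y = T (L.indicator k) y + T (Lᶜ.indicator k) y := by
      rw [← hadd _ _ (hk1.indicator hLm) (hk1.indicator hLm.compl), indicator_self_add_compl]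
    have h3 : ‖T (Lᶜ.indicator k) y‖ ≤ t / 2 := by
      have := hsmall y
      rwa [← ofReal_norm, ENNReal.ofReal_le_ofReal_iff (by positivity)] at this
    have h4 := norm_add_le (T (L.indicator k) y) (T (Lᶜ.indicator k) y)
    rw [← hsum] at h4
    have hy' : t < ‖T k y‖ := hy
    refine ENNReal.rpow_le_rpow ?_ (by norm_num)
    rw [← ofReal_norm]
    exact ENNReal.ofReal_le_ofReal (by linarith)
  have hcheb := mul_meas_ge_le_lintegral₀ (μ := π)
    (f := fun y => ‖T (L.indicator k) y‖ₑ ^ (2 : ℝ))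
    ((hmeas _ (hk1.indicator hLm)).enorm.pow_const _) (ENNReal.ofReal (t / 2) ^ (2 : ℝ))
  have hT2 := h2 _ (hk1.indicator hLm) (hk2.indicator hLm)
  have hpw : ∀ x, ‖L.indicator k x‖ₑ ^ (2 : ℝ) = L.indicator (fun x => ‖k x‖ₑ ^ (2 : ℝ)) x :=
    fun x => by by_cases hx : x ∈ L <;> simp [hx]
  simp_rw [hpw] at hT2
  rw [lintegral_indicator hLm] at hT2
  have hfin := hcheb.trans hT2
  have hinv : ENNReal.ofReal (4 * t ^ (-2 : ℝ)) * ENNReal.ofReal (t / 2) ^ (2 : ℝ) = 1 := by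
    rw [ENNReal.ofReal_rpow_of_pos (by positivity), ← ENNReal.ofReal_mul (by positivity),
      Real.div_rpow ht.le (by norm_num), Real.rpow_neg ht.le, ← ENNReal.ofReal_one]
    congr 1
    have : t ^ (2 : ℝ) ≠ 0 := (Real.rpow_pos_of_pos ht _).ne'
    field_simp
    norm_num
  calc π {y | t < ‖T k y‖} ≤ π _ := measure_mono hsub
    _ = ENNReal.ofReal (4 * t ^ (-2 : ℝ)) * (ENNReal.ofReal (t / 2) ^ (2 : ℝ) * π _) := by
        rw [← mul_assoc, hinv, one_mul]
    _ ≤ _ := by gcongr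

/-- The constant in `paley_inequality`. -/
def paleyConst (q : ℝ) (K M : ℝ≥0∞) : ℝ≥0∞ :=
  ENNReal.ofReal q * (ENNReal.ofReal (4 * (2 ^ (q - 2) / (q - 2))) * M *
    (1 + (K * ENNReal.ofReal (2 * (q - 1))) ^ (q - 1) * (3 * K)))

theorem paleyConst_ne_top {q : ℝ} (hq : 2 < q) (hK : K ≠ ⊤) (hM : M ≠ ⊤) :
    paleyConst q K M ≠ ⊤ := by
  have h : (K * ENNReal.ofReal (2 * (q - 1))) ^ (q - 1) ≠ ⊤ :=
    ENNReal.rpow_ne_top_of_nonneg (by linarith) (ENNReal.mul_ne_top hK ENNReal.ofReal_ne_top)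
  unfold paleyConst
  finiteness

theorem setLIntegral_rpow_le_of_lt {q : ℝ} (hq : 2 < q) {h : ℝ≥0∞} (hh : h ≠ ⊤) :
    ∫⁻ t in Ioi (0 : ℝ), {t : ℝ | ENNReal.ofReal (t / 2) < h}.indicator
      (fun t => ENNReal.ofReal (t ^ (q - 3))) t ≤
      ENNReal.ofReal (2 ^ (q - 2) / (q - 2)) * h ^ (q - 2) := by
  lift h to ℝ≥0 using hh
  have hm : MeasurableSet {t : ℝ | ENNReal.ofReal (t / 2) < h} :=
    measurableSet_lt (by fun_prop) measurable_const
  rw [setLIntegral_indicator hm]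
  calc _ ≤ ∫⁻ t in Ioc 0 (2 * (h : ℝ)), ENNReal.ofReal (t ^ (q - 3)) := by
        refine lintegral_mono_set ?_
        rintro t ⟨h1, h2⟩
        refine ⟨h2, ?_⟩
        have h3 : ENNReal.ofReal (t / 2) < ENNReal.ofReal h := by simpa using h1
        have := (ENNReal.ofReal_lt_ofReal_iff_of_nonneg (by have : 0 < t := h2; positivity)).1 h3
        linarith
    _ = _ := by
        rw [setLIntegral_Ioc_rpow (by linarith) (by positivity),
          show q - 3 + 1 = q - 2 by ring, Real.mul_rpow (by norm_num) h.coe_nonneg,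
          mul_div_right_comm, ENNReal.ofReal_mul (div_nonneg (by positivity) (by linarith)),
          ← ENNReal.ofReal_rpow_of_nonneg h.coe_nonneg (by linarith)]
        simp

/-- **Paley's inequality** for an additive operator which is of type `(1, ∞)` and of type `(2, 2)`,
with an arbitrary weight `ψ` whose sublevel sets grow at most linearly. -/
theorem paley_inequality [SFinite ν]
    (hadd : ∀ k l, Integrable k ν → Integrable l ν → ∀ y, T (k + l) y = T k y + T l y)
    (hmeas : ∀ k, Integrable k ν → AEStronglyMeasurable (T k) π)
    (h1 : ∀ k, Integrable k ν → ∀ y, ‖T k y‖ₑ ≤ ∫⁻ x, ‖k x‖ₑ ∂ν)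
    (h2 : ∀ k, Integrable k ν → MemLp k 2 ν →
      ∫⁻ y, ‖T k y‖ₑ ^ (2 : ℝ) ∂π ≤ M * ∫⁻ x, ‖k x‖ₑ ^ (2 : ℝ) ∂ν)
    (hψm : Measurable ψ) (hψ : ∀ x, 0 < ψ x)
    (hK : ∀ s : ℝ, 0 < s → ν {x | ψ x ≤ s} ≤ K * ENNReal.ofReal s)
    {q : ℝ} (hq : 2 < q) {k : X → ℂ} (hkm : Measurable k) (hk1 : Integrable k ν)
    (hk2 : MemLp k 2 ν) :
    ∫⁻ y, ‖T k y‖ₑ ^ q ∂π ≤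
      paleyConst q K M * ∫⁻ x, ‖k x‖ₑ ^ q * ENNReal.ofReal (ψ x ^ (q - 2)) ∂ν := by
  have hq0 : 0 < q := by linarith
  set H := sublevelIntegral ν ψ (fun x => ‖k x‖ₑ) with hH
  have hHm : Measurable H := measurable_sublevelIntegral hψm _
  have hHt : ∀ x, H x ≠ ⊤ := fun x =>
    ne_top_of_le_ne_top hk1.2.ne (setLIntegral_le_lintegral _ _)
  have hms : MeasurableSet {z : ℝ × X | ENNReal.ofReal (z.1 / 2) < H z.2} :=
    measurableSet_lt (by fun_prop) (hHm.comp measurable_snd)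
  have hms1 : ∀ t : ℝ, MeasurableSet {x : X | ENNReal.ofReal (t / 2) < H x} :=
    fun t => measurableSet_lt (by fun_prop) hHm
  have hms2 : ∀ x, MeasurableSet {t : ℝ | ENNReal.ofReal (t / 2) < H x} :=
    fun x => measurableSet_lt (by fun_prop) measurable_const
  have hcake := lintegral_rpow_eq_lintegral_meas_lt_mul π (f := fun y => ‖T k y‖)
    (Filter.Eventually.of_forall fun y => norm_nonneg _) (hmeas k hk1).norm.aemeasurable hq0
  have he : ∀ y, ENNReal.ofReal (‖T k y‖ ^ q) = ‖T k y‖ₑ ^ q := fun y => by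
    rw [← ofReal_norm, ENNReal.ofReal_rpow_of_nonneg (norm_nonneg _) hq0.le]
  simp_rw [he] at hcake
  rw [hcake, paleyConst, mul_assoc (ENNReal.ofReal q)]
  refine mul_le_mul_right ?_ _
  have hm : Measurable ({z : ℝ × X | ENNReal.ofReal (z.1 / 2) < H z.2}.indicator
      fun z => ENNReal.ofReal (z.1 ^ (q - 3)) * ‖k z.2‖ₑ ^ (2 : ℝ)) :=
    Measurable.indicator (by fun_prop) hms
  calc _ ≤ ∫⁻ t in Ioi (0 : ℝ), (ENNReal.ofReal 4 * M) * ∫⁻ x,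
          {z : ℝ × X | ENNReal.ofReal (z.1 / 2) < H z.2}.indicator
            (fun z => ENNReal.ofReal (z.1 ^ (q - 3)) * ‖k z.2‖ₑ ^ (2 : ℝ)) (t, x) ∂ν := by
        refine setLIntegral_mono ?_ fun t ht => ?_
        · exact hm.lintegral_prod_right'.const_mul _
        have ht0 : 0 < t := ht
        refine (mul_le_mul_left (measure_lt_norm_le_of_add hadd hmeas h1 h2 hψm hk1 hk2 ht0)
          _).trans (le_of_eq ?_)
        have : ∀ x, {z : ℝ × X | ENNReal.ofReal (z.1 / 2) < H z.2}.indicator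
            (fun z => ENNReal.ofReal (z.1 ^ (q - 3)) * ‖k z.2‖ₑ ^ (2 : ℝ)) (t, x) =
            ENNReal.ofReal (t ^ (q - 3)) * {x | ENNReal.ofReal (t / 2) < H x}.indicator
              (fun x => ‖k x‖ₑ ^ (2 : ℝ)) x := fun x => by
          by_cases h : ENNReal.ofReal (t / 2) < H x <;> simp [indicator, h]
        simp_rw [this]
        -- The Chebyshev factor `t^(-2)` and the layer-cake factor `t^(q-1)` combine to `t^(q-3)`,
        -- integrable at `0` because `q > 2`.
        rw [lintegral_const_mul _ (Measurable.indicator (by fun_prop) (hms1 t)),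
          lintegral_indicator (hms1 t), ENNReal.ofReal_mul (by norm_num),
          show q - 3 = -2 + (q - 1) by ring, Real.rpow_add ht0,
          ENNReal.ofReal_mul (Real.rpow_nonneg ht0.le _)]
        ring
    _ = (ENNReal.ofReal 4 * M) * ∫⁻ x, ‖k x‖ₑ ^ (2 : ℝ) * ∫⁻ t in Ioi (0 : ℝ),
          {t : ℝ | ENNReal.ofReal (t / 2) < H x}.indicator
            (fun t => ENNReal.ofReal (t ^ (q - 3))) t ∂volume ∂ν := by
        rw [lintegral_const_mul _ hm.lintegral_prod_right', lintegral_lintegral_swap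
          (f := fun t x => {z : ℝ × X | ENNReal.ofReal (z.1 / 2) < H z.2}.indicator
            (fun z => ENNReal.ofReal (z.1 ^ (q - 3)) * ‖k z.2‖ₑ ^ (2 : ℝ)) (t, x)) hm.aemeasurable]
        congr 1
        refine lintegral_congr fun x => ?_
        rw [← lintegral_const_mul _ (Measurable.indicator (by fun_prop) (hms2 x))]
        refine lintegral_congr fun t => ?_
        by_cases h : ENNReal.ofReal (t / 2) < H x <;> simp [indicator, h, mul_comm]
    _ ≤ (ENNReal.ofReal 4 * M) * ∫⁻ x, ENNReal.ofReal (2 ^ (q - 2) / (q - 2)) *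
          (‖k x‖ₑ ^ (2 : ℝ) * H x ^ (q - 2)) ∂ν := by
        refine mul_le_mul_right (lintegral_mono fun x => ?_) _
        refine (mul_le_mul_right (setLIntegral_rpow_le_of_lt hq (hHt x)) _).trans (le_of_eq ?_)
        ring
    _ ≤ _ := by
        rw [lintegral_const_mul _ (by fun_prop)]
        refine (mul_le_mul_right (mul_le_mul_right
          (lintegral_sq_mul_sublevelIntegral_rpow_le hψm hψ hK (by fun_prop) hq) _) _).trans
            (le_of_eq ?_)
        rw [ENNReal.ofReal_mul (by norm_num : (0 : ℝ) ≤ 4)]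
        ring

end Paley

/-! ### Polar coordinates for the Lorentz-invariant measure. -/

section Polar

/-- The measure `r ^ n dr` on the half-line. -/
def radialMeasure (n : ℕ) : Measure ℝ :=
  (volume.restrict (Ioi 0)).withDensity fun r => ENNReal.ofReal (r ^ n)

/-- The measure `r dr / √(r² + 1)` on the half-line. -/
def hyperbolicRadialMeasure : Measure ℝ :=
  (volume.restrict (Ioi 0)).withDensity fun r => ENNReal.ofReal (r / √(r ^ 2 + 1))

instance (n : ℕ) : SigmaFinite (radialMeasure n) :=
  SigmaFinite.withDensity_of_ne_top (Filter.Eventually.of_forall fun _ => ENNReal.ofReal_ne_top)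

instance : SigmaFinite hyperbolicRadialMeasure :=
  SigmaFinite.withDensity_of_ne_top (Filter.Eventually.of_forall fun _ => ENNReal.ofReal_ne_top)

theorem withDensity_map_comp {α β : Type*} [MeasurableSpace α] [MeasurableSpace β]
    {μ : Measure α} {g : α → β} (hg : Measurable g) {f : β → ℝ≥0∞} (hf : Measurable f) :
    (μ.map g).withDensity f = (μ.withDensity (f ∘ g)).map g := by
  ext s hs
  rw [withDensity_apply _ hs, Measure.map_apply hg hs, withDensity_apply _ (hg hs),
    setLIntegral_map hs hf hg]
  rfl

theorem map_volumeIoiPow (n : ℕ) :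
    (Measure.volumeIoiPow n).map Subtype.val = radialMeasure n := by
  rw [Measure.volumeIoiPow, radialMeasure, ← map_comap_subtype_coe measurableSet_Ioi,
    withDensity_map_comp measurable_subtype_coe (by fun_prop)]
  rfl

instance (d : ℕ) : IsFiniteMeasure (sphereMeasure d) := by
  unfold sphereMeasure; infer_instance

/-- Polar coordinates `(θ, r) ↦ r θ`. -/
def polarPoint {d : ℕ} (z : Metric.sphere (0 : Euc d) 1 × ℝ) : Euc d := z.2 • (z.1 : Euc d)

theorem continuous_polarPoint {d : ℕ} : Continuous (polarPoint (d := d)) := by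
  unfold polarPoint; fun_prop

theorem map_polarPoint {d : ℕ} (hd : 1 ≤ d) :
    ((sphereMeasure d).prod (radialMeasure (d - 1))).map polarPoint =
      (volume : Measure (Euc d)) := by
  have : Nontrivial (Euc d) := by
    have : Nonempty (Fin d) := ⟨⟨0, hd⟩⟩
    infer_instance
  have hmp := (volume : Measure (Euc d)).measurePreserving_homeomorphUnitSphereProd
  have hfr : Module.finrank ℝ (Euc d) = d := by simp
  rw [hfr] at hmp
  have h1 := hmp.symm (homeomorphUnitSphereProd (Euc d)).toMeasurableEquiv
  have h2 : ((sphereMeasure d).prod (radialMeasure (d - 1))) =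
      ((sphereMeasure d).prod (Measure.volumeIoiPow (d - 1))).map
        (Prod.map id Subtype.val) := by
    rw [← Measure.map_prod_map _ _ measurable_id measurable_subtype_coe, Measure.map_id,
      map_volumeIoiPow]
  rw [h2, Measure.map_map continuous_polarPoint.measurable (by fun_prop)]
  have h3 : (volume : Measure (Euc d)) =
      ((volume : Measure (Euc d)).comap (Subtype.val : ({0}ᶜ : Set (Euc d)) → Euc d)).map
        Subtype.val := by
    rw [map_comap_subtype_coe (measurableSet_singleton _).compl, restrict_compl_singleton]
  conv_rhs => rw [h3, ← h1.map_eq, Measure.map_map measurable_subtype_coe h1.measurable]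
  rfl

theorem norm_polarPoint_sq {d : ℕ} (z : Metric.sphere (0 : Euc d) 1 × ℝ) :
    ‖polarPoint z‖ ^ 2 = z.2 ^ 2 := by
  simp [polarPoint, norm_smul]

theorem bracket_polarPoint {d : ℕ} (z : Metric.sphere (0 : Euc d) 1 × ℝ) :
    bracket (polarPoint z) = √(z.2 ^ 2 + 1) := by
  rw [bracket, norm_polarPoint_sq]

/-- The radial density is split as `r^(d-1)/⟨r⟩ = r^(d-2) · (r/⟨r⟩)`: the second factor is `dτ` on
the hyperboloid, and the first is carried by the slices. -/
theorem lorentzMeasure_eq_map {d : ℕ} (hd : 2 ≤ d) :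
    lorentzMeasure d = ((sphereMeasure d).prod
      (hyperbolicRadialMeasure.withDensity fun r => ENNReal.ofReal (r ^ (d - 2)))).map
        (hyperboloidPoint ∘ polarPoint) := by
  have hb : Measurable fun ξ : Euc d => ENNReal.ofReal (1 / bracket ξ) := by
    have := (continuous_bracket (d := d)).measurable
    fun_prop
  have hb2 : Measurable fun r : ℝ => ENNReal.ofReal (1 / √(r ^ 2 + 1)) := by fun_prop
  rw [← Measure.map_map continuous_hyperboloidPoint.measurable continuous_polarPoint.measurable,
    lorentzMeasure, ← map_polarPoint (by lia),
    withDensity_map_comp continuous_polarPoint.measurable hb]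
  congr 2
  have e1 : (fun ξ : Euc d => ENNReal.ofReal (1 / bracket ξ)) ∘ polarPoint =
      fun z => ENNReal.ofReal (1 / √(z.2 ^ 2 + 1)) := by
    funext z; simp only [Function.comp_apply, bracket_polarPoint]
  rw [e1, ← prod_withDensity_right hb2]
  congr 1
  rw [radialMeasure, hyperbolicRadialMeasure, ← withDensity_mul _ (by fun_prop) hb2,
    ← withDensity_mul _ (by fun_prop) (by fun_prop)]
  refine withDensity_congr_ae ?_
  filter_upwards [ae_restrict_mem measurableSet_Ioi] with r (hr : 0 < r)
  simp only [Pi.mul_apply]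
  rw [← ENNReal.ofReal_mul (by positivity), ← ENNReal.ofReal_mul (by positivity)]
  congr 1
  rw [show d - 1 = (d - 2) + 1 by lia, pow_succ]
  ring

theorem hyperbolicRadialMeasure_le : hyperbolicRadialMeasure ≤ volume.restrict (Ioi 0) := by
  calc _ ≤ (volume.restrict (Ioi (0 : ℝ))).withDensity 1 := by
        refine withDensity_mono (Filter.Eventually.of_forall fun r => ?_)
        refine ENNReal.ofReal_le_one.2 (div_le_one_of_le₀ ?_ (Real.sqrt_nonneg _))
        exact Real.le_sqrt_of_sq_le (by linarith)
    _ = _ := withDensity_one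

end Polar

/-! ### Oscillatory integrals and their Gaussian-regularized energy. -/

section Gaussian

variable {X V : Type*} [MeasurableSpace X] {ν : Measure X} [NormedAddCommGroup V]
  [InnerProductSpace ℝ V]

/-- The oscillatory integral `x ↦ ∫ e^{i⟨x, v(y)⟩} k(y) dν(y)`. -/
def oscIntegral (ν : Measure X) (v : X → V) (k : X → ℂ) (x : V) : ℂ :=
  ∫ y, Complex.exp (Complex.I * ((inner ℝ x (v y) : ℝ) : ℂ)) * k y ∂ν

theorem norm_cexp_I_mul_ofReal (a : ℝ) : ‖Complex.exp (Complex.I * (a : ℂ))‖ = 1 := by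
  rw [mul_comm]; exact Complex.norm_exp_ofReal_mul_I a

theorem enorm_oscIntegral_le (v : X → V) (k : X → ℂ) (x : V) :
    ‖oscIntegral ν v k x‖ₑ ≤ ∫⁻ y, ‖k y‖ₑ ∂ν := by
  refine (enorm_integral_le_lintegral_enorm _).trans (lintegral_mono fun y => ?_)
  rw [enorm_mul, ← ofReal_norm (Complex.exp _), norm_cexp_I_mul_ofReal]
  simp

variable [FiniteDimensional ℝ V] [MeasurableSpace V] [BorelSpace V]

theorem integrable_cexp_mul {v : X → V} (hv : Measurable v) {k : X → ℂ} (hk : Integrable k ν)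
    (x : V) : Integrable (fun y => Complex.exp (Complex.I * ((inner ℝ x (v y) : ℝ) : ℂ)) * k y) ν :=
  hk.bdd_mul (c := 1) (by fun_prop)
    (Filter.Eventually.of_forall fun y => (norm_cexp_I_mul_ofReal _).le)

theorem continuous_oscIntegral {v : X → V} (hv : Measurable v) {k : X → ℂ} (hk : Integrable k ν) :
    Continuous (oscIntegral ν v k) := by
  refine continuous_of_dominated (fun x => (integrable_cexp_mul hv hk x).aestronglyMeasurable)
    (fun x => Filter.Eventually.of_forall fun y => ?_) hk.norm
    (Filter.Eventually.of_forall fun y => by fun_prop)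
  rw [norm_mul, norm_cexp_I_mul_ofReal, one_mul]

-- Expand the square as a double integral, swap by Fubini (the Gaussian makes everything integrable)
-- and compute the Fourier transform of the Gaussian. The identity serves twice: for the upper bound
-- in Plancherel on the line and for a lower bound on the sphere.
open Complex ComplexConjugate in
theorem integral_norm_sq_oscIntegral_mul_gaussian [SFinite ν] {v : X → V} (hv : Measurable v)
    {k : X → ℂ} (hk : Integrable k ν) {ε : ℝ} (hε : 0 < ε) :
    ∫ x : V, ((‖oscIntegral ν v k x‖ ^ 2 * Real.exp (-ε * ‖x‖ ^ 2) : ℝ) : ℂ) =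
      ∫ z : X × X, k z.1 * conj (k z.2) * (((Real.pi / ε) ^ (Module.finrank ℝ V / 2 : ℝ) *
        Real.exp (-‖v z.1 - v z.2‖ ^ 2 / (4 * ε)) : ℝ) : ℂ) ∂(ν.prod ν) := by
  have hkk : Integrable (fun z : X × X => k z.1 * conj (k z.2)) (ν.prod ν) :=
    hk.mul_prod ((Complex.conjCLE : ℂ →L[ℝ] ℂ).integrable_comp hk)
  have hg : Integrable (fun x : V => (Real.exp (-ε * ‖x‖ ^ 2) : ℂ)) := by
    have := GaussianFourier.integrable_cexp_neg_mul_sq_norm_add (b := (ε : ℂ)) (by simpa using hε)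
      0 (0 : V)
    simpa using this
  have h1 : ∀ x : V, ((‖oscIntegral ν v k x‖ ^ 2 * Real.exp (-ε * ‖x‖ ^ 2) : ℝ) : ℂ) =
      ∫ z : X × X, cexp (I * ((inner ℝ x (v z.1 - v z.2) : ℝ) : ℂ)) *
        ((Real.exp (-ε * ‖x‖ ^ 2) : ℂ) * (k z.1 * conj (k z.2))) ∂(ν.prod ν) := fun x => by
    have e1 : ((‖oscIntegral ν v k x‖ ^ 2 : ℝ) : ℂ) =
        oscIntegral ν v k x * conj (oscIntegral ν v k x) := by
      rw [Complex.mul_conj, Complex.normSq_eq_norm_sq]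
    rw [Complex.ofReal_mul, e1]
    nth_rw 2 [oscIntegral]
    rw [← integral_conj, oscIntegral, ← integral_prod_mul, ← integral_mul_const]
    refine integral_congr_ae (Filter.Eventually.of_forall fun z => ?_)
    have e2 : cexp (I * ((inner ℝ x (v z.1 - v z.2) : ℝ) : ℂ)) =
        cexp (I * ((inner ℝ x (v z.1) : ℝ) : ℂ)) *
          conj (cexp (I * ((inner ℝ x (v z.2) : ℝ) : ℂ))) := by
      rw [← Complex.exp_conj, ← Complex.exp_add, inner_sub_right]
      congr 1
      simp only [map_mul, conj_I, conj_ofReal, ofReal_sub]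
      ring
    simp only [e2, map_mul]
    ring
  simp_rw [h1]
  have hint : Integrable (Function.uncurry fun (x : V) (z : X × X) =>
      cexp (I * ((inner ℝ x (v z.1 - v z.2) : ℝ) : ℂ)) *
        ((Real.exp (-ε * ‖x‖ ^ 2) : ℂ) * (k z.1 * conj (k z.2)))) (volume.prod (ν.prod ν)) := by
    refine Integrable.bdd_mul (c := 1) (hg.mul_prod hkk) ?_
      (Filter.Eventually.of_forall fun z => (norm_cexp_I_mul_ofReal _).le)
    have : Measurable fun p : V × (X × X) => (inner ℝ p.1 (v p.2.1 - v p.2.2) : ℝ) := by fun_prop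
    fun_prop
  rw [integral_integral_swap hint]
  refine integral_congr_ae (Filter.Eventually.of_forall fun z => ?_)
  have h2 := GaussianFourier.integral_cexp_neg_mul_sq_norm_add (b := (ε : ℂ)) (by simpa using hε)
    I (v z.1 - v z.2)
  have e3 : ∀ x : V, cexp (I * ((inner ℝ x (v z.1 - v z.2) : ℝ) : ℂ)) *
        ((Real.exp (-ε * ‖x‖ ^ 2) : ℂ) * (k z.1 * conj (k z.2))) =
      cexp (-(ε : ℂ) * (‖x‖ : ℂ) ^ 2 + I * ((inner ℝ (v z.1 - v z.2) x : ℝ) : ℂ)) *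
        (k z.1 * conj (k z.2)) := fun x => by
    rw [← mul_assoc, Complex.ofReal_exp, ← Complex.exp_add, real_inner_comm]
    congr 2
    push_cast
    ring
  simp only [e3]
  rw [integral_mul_const, h2, mul_comm]
  congr 1
  have e4 : ((Real.pi / ε : ℂ)) ^ (Module.finrank ℝ V / 2 : ℂ) =
      (((Real.pi / ε) ^ (Module.finrank ℝ V / 2 : ℝ) : ℝ) : ℂ) := by
    rw [Complex.ofReal_cpow (by positivity)]
    push_cast
    rfl
  rw [e4, Complex.ofReal_mul]
  congr 1
  rw [Complex.ofReal_exp]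
  congr 1
  push_cast
  rw [I_sq]
  ring

end Gaussian

/-! ### The `L²` bound for the Fourier transform on the line. -/

section Plancherel

theorem lintegral_gaussian_sub (a ε : ℝ) (hε : 0 < ε) :
    ∫⁻ z : ℝ, ENNReal.ofReal (Real.exp (-(a - z) ^ 2 / (4 * ε))) =
      ENNReal.ofReal √(Real.pi / (1 / (4 * ε))) := by
  have h : ∀ z : ℝ, Real.exp (-(a - z) ^ 2 / (4 * ε)) =
      (fun x => Real.exp (-(1 / (4 * ε)) * x ^ 2)) (a - z) := fun z => by
    simp only; congr 1; ring
  simp_rw [h]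
  rw [lintegral_sub_left_eq_self (fun x => ENNReal.ofReal (Real.exp (-(1 / (4 * ε)) * x ^ 2))) a,
    ← ofReal_integral_eq_lintegral_ofReal (integrable_exp_neg_mul_sq (by positivity))
      (Filter.Eventually.of_forall fun x => (Real.exp_pos _).le), integral_gaussian]

/-- Schur's test on the Gaussian energy: `|k(y) k(z)| ≤ (|k(y)|² + |k(z)|²)/2`, and the kernel has
the same integral in either variable. -/
theorem lintegral_oscIntegral_sq_mul_gaussian_le {k : ℝ → ℂ} (hk : Integrable k)
    {ε : ℝ} (hε : 0 < ε) :
    ∫⁻ t : ℝ, ‖oscIntegral volume (fun y : ℝ => y) k t‖ₑ ^ (2 : ℝ) *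
        ENNReal.ofReal (Real.exp (-ε * ‖t‖ ^ 2)) ≤
      ENNReal.ofReal (2 * Real.pi) * ∫⁻ y, ‖k y‖ₑ ^ (2 : ℝ) := by
  set g := oscIntegral volume (fun y : ℝ => y) k
  have hgc : Continuous g := continuous_oscIntegral measurable_id hk
  have hgb : ∀ t, ‖g t‖ ≤ (∫⁻ y, ‖k y‖ₑ).toReal := fun t => by
    have := enorm_oscIntegral_le (ν := volume) (fun y : ℝ => y) k t
    rw [← ofReal_norm] at this
    exact (ENNReal.ofReal_le_iff_le_toReal hk.2.ne).1 this
  have hgauss : Integrable fun t : ℝ => Real.exp (-ε * ‖t‖ ^ 2) := by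
    simpa using integrable_exp_neg_mul_sq hε
  have hint : Integrable fun t : ℝ => ‖g t‖ ^ 2 * Real.exp (-ε * ‖t‖ ^ 2) := by
    refine hgauss.bdd_mul (c := (∫⁻ y, ‖k y‖ₑ).toReal ^ 2) (by fun_prop)
      (Filter.Eventually.of_forall fun t => ?_)
    rw [norm_pow, norm_norm]
    gcongr
    exact hgb t
  have hid := integral_norm_sq_oscIntegral_mul_gaussian (ν := volume) (v := fun y : ℝ => y)
    measurable_id hk hε
  have hL : ∫⁻ t : ℝ, ‖g t‖ₑ ^ (2 : ℝ) * ENNReal.ofReal (Real.exp (-ε * ‖t‖ ^ 2)) =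
      ‖∫ t : ℝ, ((‖g t‖ ^ 2 * Real.exp (-ε * ‖t‖ ^ 2) : ℝ) : ℂ)‖ₑ := by
    rw [integral_complex_ofReal, ← ofReal_norm, Complex.norm_real, Real.norm_of_nonneg
      (integral_nonneg fun t => by positivity),
      ofReal_integral_eq_lintegral_ofReal hint
        (Filter.Eventually.of_forall fun t => by positivity)]
    refine lintegral_congr fun t => ?_
    rw [ENNReal.ofReal_mul (by positivity), ← ofReal_norm (g t),
      ENNReal.ofReal_rpow_of_nonneg (norm_nonneg _) (by norm_num), Real.rpow_two]
  rw [hL, hid]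
  refine (enorm_integral_le_lintegral_enorm _).trans ?_
  set c := ENNReal.ofReal ((Real.pi / ε) ^ (Module.finrank ℝ ℝ / 2 : ℝ)) with hc
  set E : ℝ → ℝ → ℝ≥0∞ := fun y z => ENNReal.ofReal (Real.exp (-(y - z) ^ 2 / (4 * ε))) with hE
  have hEm : Measurable (Function.uncurry E) := by
    simp only [hE, Function.uncurry_def]; fun_prop
  have hEm1 : ∀ y, Measurable (E y) := fun y => by simp only [hE]; fun_prop
  have hEs : ∀ y z, E y z = E z y := fun y z => by simp only [hE]; congr 3; ring
  have hk2 : AEMeasurable (fun y => ‖k y‖ₑ ^ (2 : ℝ)) := hk.1.enorm.pow_const _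
  have hA : ∫⁻ z : ℝ × ℝ, c * (‖k z.1‖ₑ ^ (2 : ℝ) * E z.1 z.2) ∂(volume.prod volume) =
      c * (ENNReal.ofReal √(Real.pi / (1 / (4 * ε))) * ∫⁻ y, ‖k y‖ₑ ^ (2 : ℝ)) := by
    have hm : AEMeasurable (fun z : ℝ × ℝ => ‖k z.1‖ₑ ^ (2 : ℝ) * E z.1 z.2)
        (volume.prod volume) :=
      (hk2.comp_fst).mul hEm.aemeasurable
    rw [lintegral_const_mul'' _ hm, lintegral_prod _ hm]
    congr 1
    rw [← lintegral_const_mul'' _ hk2]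
    refine lintegral_congr fun y => ?_
    simp only
    rw [lintegral_const_mul _ (hEm1 y), lintegral_gaussian_sub y ε hε, mul_comm]
  have hB : ∫⁻ z : ℝ × ℝ, c * (‖k z.2‖ₑ ^ (2 : ℝ) * E z.1 z.2) ∂(volume.prod volume) =
      c * (ENNReal.ofReal √(Real.pi / (1 / (4 * ε))) * ∫⁻ y, ‖k y‖ₑ ^ (2 : ℝ)) := by
    rw [← hA, ← lintegral_prod_swap]
    refine lintegral_congr fun z => ?_
    simp [hEs z.2 z.1]
  calc _ ≤ ∫⁻ z : ℝ × ℝ, 2⁻¹ * (c * (‖k z.1‖ₑ ^ (2 : ℝ) * E z.1 z.2) +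
          c * (‖k z.2‖ₑ ^ (2 : ℝ) * E z.1 z.2)) ∂(volume.prod volume) := by
        refine lintegral_mono fun z => ?_
        have hyoung := ENNReal.young_inequality ‖k z.1‖ₑ ‖k z.2‖ₑ Real.HolderConjugate.two_two
        have e : ‖((((Real.pi / ε) ^ (Module.finrank ℝ ℝ / 2 : ℝ) *
            Real.exp (-‖z.1 - z.2‖ ^ 2 / (4 * ε)) : ℝ)) : ℂ)‖ₑ = c * E z.1 z.2 := by
          rw [← ofReal_norm, Complex.norm_real, Real.norm_of_nonneg (by positivity),
            ENNReal.ofReal_mul (by positivity), Real.norm_eq_abs, sq_abs]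
        rw [enorm_mul, enorm_mul, e, RCLike.enorm_conj]
        refine (mul_le_mul_left hyoung _).trans (le_of_eq ?_)
        rw [ENNReal.div_eq_inv_mul, ENNReal.div_eq_inv_mul]
        simp only [ENNReal.ofReal_ofNat]
        ring
    _ = c * (ENNReal.ofReal √(Real.pi / (1 / (4 * ε))) * ∫⁻ y, ‖k y‖ₑ ^ (2 : ℝ)) := by
        have hm : AEMeasurable (fun z : ℝ × ℝ => c * (‖k z.1‖ₑ ^ (2 : ℝ) * E z.1 z.2))
            (volume.prod volume) := ((hk2.comp_fst).mul hEm.aemeasurable).const_mul _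
        rw [lintegral_const_mul' _ _ (by simp), lintegral_add_left' hm, hA, hB, ← two_mul,
          ← mul_assoc, ENNReal.inv_mul_cancel (by norm_num) (by norm_num), one_mul]
    _ = _ := by
        rw [← mul_assoc, hc, ← ENNReal.ofReal_mul (by positivity)]
        congr 2
        -- The Gaussian normalization `√(π/ε)` times the kernel mass `√(4πε)` equals `2π` for every
        -- `ε`.
        rw [Module.finrank_self, Nat.cast_one, ← Real.sqrt_eq_rpow, ← Real.sqrt_mul (by positivity),
          show Real.pi / ε * (Real.pi / (1 / (4 * ε))) = (2 * Real.pi) ^ 2 by field_simp; ring,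
          Real.sqrt_sq (by positivity)]

/-- Fatou along `ε = 1/(n+1)`, since the regularized bound is uniform in `ε`. -/
theorem lintegral_oscIntegral_sq_le {k : ℝ → ℂ} (hk : Integrable k) :
    ∫⁻ t : ℝ, ‖oscIntegral volume (fun y : ℝ => y) k t‖ₑ ^ (2 : ℝ) ≤
      ENNReal.ofReal (2 * Real.pi) * ∫⁻ y, ‖k y‖ₑ ^ (2 : ℝ) := by
  set g := oscIntegral volume (fun y : ℝ => y) k
  have hgc : Continuous g := continuous_oscIntegral measurable_id hk
  have hlim : ∀ t : ℝ, Filter.Tendsto (fun n : ℕ => ‖g t‖ₑ ^ (2 : ℝ) *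
      ENNReal.ofReal (Real.exp (-(1 / ((n : ℝ) + 1)) * ‖t‖ ^ 2))) Filter.atTop
      (nhds (‖g t‖ₑ ^ (2 : ℝ))) := fun t => by
    have h1 : Filter.Tendsto (fun n : ℕ => Real.exp (-(1 / ((n : ℝ) + 1)) * ‖t‖ ^ 2))
        Filter.atTop (nhds 1) := by
      have := (Real.continuous_exp.tendsto _).comp
        (((tendsto_one_div_add_atTop_nhds_zero_nat (𝕜 := ℝ)).neg).mul_const (‖t‖ ^ 2))
      simpa [Function.comp_def] using this
    have h2 := ENNReal.Tendsto.const_mul (a := ‖g t‖ₑ ^ (2 : ℝ))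
      ((ENNReal.continuous_ofReal.tendsto _).comp h1) (Or.inr (by simp))
    simpa using h2
  have : ∀ t, ‖g t‖ₑ ^ (2 : ℝ) = Filter.liminf (fun n : ℕ => ‖g t‖ₑ ^ (2 : ℝ) *
      ENNReal.ofReal (Real.exp (-(1 / ((n : ℝ) + 1)) * ‖t‖ ^ 2))) Filter.atTop :=
    fun t => (hlim t).liminf_eq.symm
  rw [lintegral_congr this]
  refine (lintegral_liminf_le fun n => by fun_prop).trans ?_
  refine Filter.liminf_le_of_le (by isBoundedDefault) fun b hb => ?_
  obtain ⟨n, hn⟩ := hb.exists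
  exact hn.trans (lintegral_oscIntegral_sq_mul_gaussian_le hk (by positivity))

end Plancherel

/-! ### The radial oscillatory integral as a Fourier transform in `τ`. -/

section HyperbolicRadial

/-- Change of variables `τ = √(r² + 1)`, for which `dτ = r dr / √(r² + 1)`. -/
theorem map_sqrt_sq_add_one_hyperbolicRadialMeasure :
    hyperbolicRadialMeasure.map (fun r : ℝ => √(r ^ 2 + 1)) = volume.restrict (Ioi 1) := by
  have hbm : Measurable fun r : ℝ => √(r ^ 2 + 1) := by fun_prop
  ext s hs
  rw [Measure.map_apply hbm hs, Measure.restrict_apply hs, hyperbolicRadialMeasure,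
    withDensity_apply _ (hbm hs), Measure.restrict_restrict (hbm hs)]
  set A : Set ℝ := (fun r : ℝ => √(r ^ 2 + 1)) ⁻¹' s ∩ Ioi 0 with hA
  have hAm : MeasurableSet A := (hbm hs).inter measurableSet_Ioi
  have himg : (fun r : ℝ => √(r ^ 2 + 1)) '' A = s ∩ Ioi 1 := by
    ext τ
    constructor
    · rintro ⟨r, ⟨h1, h2⟩, rfl⟩
      refine ⟨h1, ?_⟩
      have : (0 : ℝ) < r := h2
      show 1 < √(r ^ 2 + 1)
      rw [Real.lt_sqrt (by norm_num)]
      nlinarith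
    · rintro ⟨h1, h2⟩
      have h2' : (1 : ℝ) < τ := h2
      have h3 : √(√(τ ^ 2 - 1) ^ 2 + 1) = τ := by
        rw [Real.sq_sqrt (by nlinarith), sub_add_cancel, Real.sqrt_sq (by linarith)]
      refine ⟨√(τ ^ 2 - 1), ⟨?_, ?_⟩, h3⟩
      · show √(√(τ ^ 2 - 1) ^ 2 + 1) ∈ s
        rwa [h3]
      · exact Real.sqrt_pos.2 (by nlinarith)
  have hinj : InjOn (fun r : ℝ => √(r ^ 2 + 1)) A := by
    intro r hr r' hr' h
    have h' : √(r ^ 2 + 1) = √(r' ^ 2 + 1) := h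
    have hr0 : (0 : ℝ) < r := hr.2
    have hr0' : (0 : ℝ) < r' := hr'.2
    rw [Real.sqrt_inj (by positivity) (by positivity)] at h'
    have : r ^ 2 = r' ^ 2 := by linarith
    exact (pow_left_inj₀ hr0.le hr0'.le two_ne_zero).1 this
  have hderiv : ∀ r ∈ A, HasDerivWithinAt (fun r : ℝ => √(r ^ 2 + 1)) (r / √(r ^ 2 + 1)) A r := by
    intro r _
    have h := ((hasDerivAt_pow 2 r).add_const (1 : ℝ)).sqrt (by positivity)
    rw [Nat.cast_ofNat, show 2 - 1 = 1 from rfl, pow_one, mul_div_mul_left _ _ two_ne_zero] at h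
    exact h.hasDerivWithinAt
  have key := lintegral_image_eq_lintegral_abs_deriv_mul hAm hderiv hinj (fun _ => 1)
  rw [himg, setLIntegral_one] at key
  rw [key]
  refine setLIntegral_congr_fun hAm fun r hr => ?_
  have : (0 : ℝ) < r := hr.2
  simp only [mul_one]
  rw [abs_of_nonneg (by positivity)]

theorem measurePreserving_sqrt_sq_sub_one :
    MeasurePreserving (fun τ : ℝ => √(τ ^ 2 - 1)) (volume.restrict (Ioi 1))
      hyperbolicRadialMeasure := by
  refine ⟨by fun_prop, ?_⟩
  rw [← map_sqrt_sq_add_one_hyperbolicRadialMeasure, Measure.map_map (by fun_prop) (by fun_prop)]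
  have hpos : ∀ᵐ r ∂hyperbolicRadialMeasure, 0 < r :=
    (withDensity_absolutelyContinuous _ _).ae_le (ae_restrict_mem measurableSet_Ioi)
  conv_rhs => rw [← Measure.map_id (μ := hyperbolicRadialMeasure)]
  refine Measure.map_congr ?_
  filter_upwards [hpos] with r hr
  simp only [Function.comp_apply, id]
  rw [Real.sq_sqrt (by positivity), add_sub_cancel_right, Real.sqrt_sq hr.le]

theorem lintegral_oscIntegral_hyperbolicRadialMeasure_sq_le {k : ℝ → ℂ}
    (hkm : Measurable k) (hk : Integrable k hyperbolicRadialMeasure) :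
    ∫⁻ t : ℝ, ‖oscIntegral hyperbolicRadialMeasure (fun r => √(r ^ 2 + 1)) k t‖ₑ ^ (2 : ℝ) ≤
      ENNReal.ofReal (2 * Real.pi) * ∫⁻ r, ‖k r‖ₑ ^ (2 : ℝ) ∂hyperbolicRadialMeasure := by
  have hmp := measurePreserving_sqrt_sq_sub_one
  set l : ℝ → ℂ := (Ioi (1 : ℝ)).indicator fun τ => k √(τ ^ 2 - 1) with hl
  have hli : Integrable l :=
    (integrable_indicator_iff measurableSet_Ioi).2 ((hmp.integrable_comp hk.1).2 hk)
  have hosc : ∀ t : ℝ, oscIntegral hyperbolicRadialMeasure (fun r => √(r ^ 2 + 1)) k t =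
      oscIntegral volume (fun y : ℝ => y) l t := fun t => by
    rw [oscIntegral, oscIntegral, ← hmp.map_eq, integral_map hmp.aemeasurable
      (Measurable.aestronglyMeasurable (by fun_prop)),
      ← integral_indicator measurableSet_Ioi]
    refine integral_congr_ae (Filter.Eventually.of_forall fun τ => ?_)
    by_cases hτ : τ ∈ Ioi (1 : ℝ)
    · have hτ' : (1 : ℝ) < τ := hτ
      simp only [hl, indicator_of_mem hτ]
      rw [Real.sq_sqrt (by nlinarith), sub_add_cancel, Real.sqrt_sq (by linarith)]
    · simp only [hl, indicator_of_notMem hτ, mul_zero]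
  have hsq : ∫⁻ r, ‖k r‖ₑ ^ (2 : ℝ) ∂hyperbolicRadialMeasure = ∫⁻ τ, ‖l τ‖ₑ ^ (2 : ℝ) := by
    rw [← hmp.lintegral_comp (by fun_prop), ← lintegral_indicator measurableSet_Ioi]
    refine lintegral_congr fun τ => ?_
    by_cases hτ : τ ∈ Ioi (1 : ℝ) <;> simp [hl, hτ]
  simp_rw [hosc]
  rw [hsq]
  exact lintegral_oscIntegral_sq_le hli

theorem lintegral_oscIntegral_restrict_sq_le {S : Set ℝ} (hS : MeasurableSet S) {k : ℝ → ℂ}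
    (hk : Integrable k (hyperbolicRadialMeasure.restrict S)) :
    ∫⁻ t : ℝ, ‖oscIntegral (hyperbolicRadialMeasure.restrict S)
        (fun r => √(r ^ 2 + 1)) k t‖ₑ ^ (2 : ℝ) ≤
      ENNReal.ofReal (2 * Real.pi) *
        ∫⁻ r, ‖k r‖ₑ ^ (2 : ℝ) ∂(hyperbolicRadialMeasure.restrict S) := by
  -- Integrability gives only a.e. measurability of `k`, so a measurable representative is extended
  -- by zero outside `S`.
  obtain ⟨l, hlm, hkl⟩ := hk.1
  have hlm := hlm.measurable
  have h0 := lintegral_oscIntegral_hyperbolicRadialMeasure_sq_le (k := S.indicator l)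
    (hlm.indicator hS) ((integrable_indicator_iff hS).2 (hk.congr hkl))
  have h1 : ∀ t : ℝ, oscIntegral (hyperbolicRadialMeasure.restrict S)
        (fun r => √(r ^ 2 + 1)) k t =
      oscIntegral hyperbolicRadialMeasure (fun r => √(r ^ 2 + 1)) (S.indicator l) t := fun t => by
    rw [oscIntegral, oscIntegral]
    have : ∀ r, Complex.exp (Complex.I * ((inner ℝ t √(r ^ 2 + 1) : ℝ) : ℂ)) * S.indicator l r =
        S.indicator (fun r => Complex.exp (Complex.I * ((inner ℝ t √(r ^ 2 + 1) : ℝ) : ℂ)) * l r)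
          r := fun r => by by_cases hr : r ∈ S <;> simp [hr]
    simp_rw [this]
    rw [integral_indicator hS]
    refine integral_congr_ae ?_
    filter_upwards [hkl] with r hr
    rw [hr]
  have h2 : ∫⁻ r, ‖S.indicator l r‖ₑ ^ (2 : ℝ) ∂hyperbolicRadialMeasure =
      ∫⁻ r, ‖k r‖ₑ ^ (2 : ℝ) ∂(hyperbolicRadialMeasure.restrict S) := by
    have : ∀ r, ‖S.indicator l r‖ₑ ^ (2 : ℝ) = S.indicator (fun r => ‖l r‖ₑ ^ (2 : ℝ)) r :=
      fun r => by by_cases hr : r ∈ S <;> simp [hr]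
    simp_rw [this]
    rw [lintegral_indicator hS]
    refine lintegral_congr_ae ?_
    filter_upwards [hkl] with r hr
    rw [hr]
  simp_rw [h1]
  rw [← h2]
  exact h0

/-- Paley's inequality for `k ↦ ∫ e^{it√(r²+1)} k(r) r dr / √(r²+1)`. -/
theorem lintegral_oscIntegral_rpow_le {S : Set ℝ} (hS : MeasurableSet S) {ψ : ℝ → ℝ}
    (hψm : Measurable ψ) (hψ : ∀ r, 0 < ψ r) {K : ℝ≥0∞}
    (hK : ∀ s : ℝ, 0 < s →
      hyperbolicRadialMeasure.restrict S {r | ψ r ≤ s} ≤ K * ENNReal.ofReal s)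
    {q : ℝ} (hq : 2 < q) {k : ℝ → ℂ} (hkm : Measurable k)
    (hk1 : Integrable k (hyperbolicRadialMeasure.restrict S))
    (hk2 : MemLp k 2 (hyperbolicRadialMeasure.restrict S)) :
    ∫⁻ t : ℝ, ‖oscIntegral (hyperbolicRadialMeasure.restrict S)
        (fun r => √(r ^ 2 + 1)) k t‖ₑ ^ q ≤
      paleyConst q K (ENNReal.ofReal (2 * Real.pi)) *
        ∫⁻ r in S, ‖k r‖ₑ ^ q * ENNReal.ofReal (ψ r ^ (q - 2)) ∂hyperbolicRadialMeasure := by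
  have hb : Measurable fun r : ℝ => √(r ^ 2 + 1) := by fun_prop
  refine paley_inequality (T := oscIntegral (hyperbolicRadialMeasure.restrict S)
    (fun r => √(r ^ 2 + 1))) (fun k l hk hl t => ?_)
    (fun k hk => (continuous_oscIntegral hb hk).aestronglyMeasurable)
    (fun k _ t => enorm_oscIntegral_le _ k t)
    (fun k hk _ => lintegral_oscIntegral_restrict_sq_le hS hk) hψm hψ hK hq hkm hk1 hk2
  rw [oscIntegral, oscIntegral, oscIntegral, ← integral_add (integrable_cexp_mul hb hk t)
    (integrable_cexp_mul hb hl t)]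
  simp only [Pi.add_apply, mul_add]

end HyperbolicRadial

/-! ### The necessary condition `q ≥ 2d/(d-1)` for the sphere. -/

section SphereFourier

variable {d : ℕ}

theorem radialMeasure_Iic_zero (n : ℕ) : radialMeasure n (Iic 0) = 0 := by
  refine (withDensity_absolutelyContinuous _ _) ?_
  rw [Measure.restrict_apply measurableSet_Iic, Iic_inter_Ioi, Ioc_self, measure_empty]

theorem radialMeasure_Ioo_le (n : ℕ) {h : ℝ} (h1 : h ≤ 1) :
    radialMeasure n (Ioo (1 - h) (1 + h)) ≤ ENNReal.ofReal (2 ^ n * (2 * h)) := by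
  rw [radialMeasure, withDensity_apply _ measurableSet_Ioo]
  calc _ ≤ ∫⁻ r in Ioo (1 - h) (1 + h), ENNReal.ofReal (2 ^ n) ∂(volume.restrict (Ioi 0)) := by
        refine setLIntegral_mono measurable_const fun r hr => ENNReal.ofReal_le_ofReal ?_
        exact pow_le_pow_left₀ (by linarith [hr.1]) (by linarith [hr.2]) n
    _ ≤ _ := by
        rw [setLIntegral_const, ENNReal.ofReal_mul (by positivity)]
        gcongr
        refine (Measure.restrict_apply_le _ _).trans ?_
        rw [Real.volume_Ioo]
        exact ENNReal.ofReal_le_ofReal (by linarith)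

/-- A cap of radius `2 h` in the sphere `𝕊^{d-1}` has measure at least `c h ^ (d - 1)`. -/
theorem sphereMeasure_ball_ge (hd : 1 ≤ d) (θ : Metric.sphere (0 : Euc d) 1) {h : ℝ} (h0 : 0 < h)
    (h1 : h ≤ 1) :
    (volume : Measure (Euc d)).real (Metric.ball 0 1) / 2 ^ d * h ^ (d - 1) ≤
      (sphereMeasure d).real (Metric.ball θ (2 * h)) := by
  -- A Euclidean ball of radius `h` about `θ` lies in the polar box over the cap, so comparing
  -- volumes bounds the cap from below. `polarPoint` also accepts `r ≤ 0`; that part is null for the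
  -- radial measure.
  have hsub : polarPoint ⁻¹' (Metric.ball (θ : Euc d) h) ⊆
      (Metric.ball θ (2 * h)) ×ˢ (Ioo (1 - h) (1 + h)) ∪ univ ×ˢ (Iic 0) := by
    rintro ⟨ω, r⟩ hz
    rcases le_or_gt r 0 with hr | hr
    · exact Or.inr ⟨trivial, hr⟩
    refine Or.inl ?_
    have hz' : ‖r • (ω : Euc d) - (θ : Euc d)‖ < h := by
      simpa [polarPoint, dist_eq_norm] using hz
    have e1 : ‖r • (ω : Euc d)‖ = r := by simp [norm_smul, abs_of_pos hr]
    have e2 : ‖(θ : Euc d)‖ = 1 := by simp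
    have e3 : |r - 1| < h := by
      have := abs_norm_sub_norm_le (r • (ω : Euc d)) (θ : Euc d)
      rw [e1, e2] at this
      linarith
    have e4 : ‖(ω : Euc d) - r • (ω : Euc d)‖ = |r - 1| := by
      have : (ω : Euc d) - r • (ω : Euc d) = (1 - r) • (ω : Euc d) := by rw [sub_smul, one_smul]
      rw [this, norm_smul, Real.norm_eq_abs, abs_sub_comm]
      simp
    have e5 : ‖(ω : Euc d) - (θ : Euc d)‖ < 2 * h := by
      have := norm_sub_le_norm_sub_add_norm_sub (ω : Euc d) (r • (ω : Euc d)) (θ : Euc d)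
      linarith
    rw [abs_lt] at e3
    refine ⟨?_, ?_, ?_⟩
    · rw [Metric.mem_ball, Subtype.dist_eq, dist_eq_norm]; exact e5
    · show 1 - h < r
      linarith
    · show r < 1 + h
      linarith
  have hvol : (volume : Measure (Euc d)) (Metric.ball (θ : Euc d) h) =
      ENNReal.ofReal (h ^ d) * volume (Metric.ball (0 : Euc d) 1) := by
    rw [Measure.addHaar_ball_of_pos _ _ h0]; simp
  have hle : (volume : Measure (Euc d)) (Metric.ball (θ : Euc d) h) ≤
      sphereMeasure d (Metric.ball θ (2 * h)) * ENNReal.ofReal (2 ^ (d - 1) * (2 * h)) := by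
    rw [← map_polarPoint hd, Measure.map_apply continuous_polarPoint.measurable measurableSet_ball]
    refine (measure_mono hsub).trans ((measure_union_le _ _).trans ?_)
    rw [Measure.prod_prod, Measure.prod_prod, radialMeasure_Iic_zero, mul_zero, add_zero]
    gcongr
    exact radialMeasure_Ioo_le _ h1
  rw [hvol] at hle
  have hreal := ENNReal.toReal_mono (by finiteness) hle
  rw [ENNReal.toReal_mul, ENNReal.toReal_mul, ENNReal.toReal_ofReal (by positivity),
    ENNReal.toReal_ofReal (by positivity)] at hreal
  change h ^ d * volume.real (Metric.ball (0 : Euc d) 1) ≤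
    (sphereMeasure d).real (Metric.ball θ (2 * h)) * (2 ^ (d - 1) * (2 * h)) at hreal
  obtain ⟨n, rfl⟩ : ∃ n, d = n + 1 := ⟨d - 1, by lia⟩
  rw [Nat.add_sub_cancel] at hreal ⊢
  rw [div_mul_eq_mul_div, div_le_iff₀ (by positivity)]
  refine le_of_mul_le_mul_right ?_ h0
  calc _ = h ^ (n + 1) * volume.real (Metric.ball (0 : Euc (n + 1)) 1) := by ring
    _ ≤ _ := hreal
    _ = _ := by ring

/-- The Gaussian energy of the surface measure of the sphere. -/
theorem integral_gaussian_sphere_ge (hd : 1 ≤ d) :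
    ∃ c : ℝ, 0 < c ∧ ∀ ε : ℝ, 0 < ε → ε ≤ 1 →
      c * ε ^ (((d : ℝ) - 1) / 2) ≤ ∫ z, Real.exp (-‖(z.1 : Euc d) - (z.2 : Euc d)‖ ^ 2 / (4 * ε))
        ∂((sphereMeasure d).prod (sphereMeasure d)) := by
  have : Nontrivial (Euc d) := by
    have : Nonempty (Fin d) := ⟨⟨0, hd⟩⟩
    infer_instance
  set c0 := (volume : Measure (Euc d)).real (Metric.ball 0 1) / 2 ^ d with hc0
  have hc0p : 0 < c0 := by
    have : 0 < (volume : Measure (Euc d)).real (Metric.ball 0 1) :=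
      ENNReal.toReal_pos (Metric.measure_ball_pos _ _ one_pos).ne' measure_ball_lt_top.ne
    positivity
  have hsp : 0 < (sphereMeasure d).real univ := by
    refine ENNReal.toReal_pos ?_ (measure_ne_top _ _)
    rw [Measure.measure_univ_ne_zero]
    exact Measure.toSphere_ne_zero _
  refine ⟨(sphereMeasure d).real univ * (Real.exp (-1) * c0), by positivity, fun ε h0 h1 => ?_⟩
  have hint : Integrable (fun z : Metric.sphere (0 : Euc d) 1 × Metric.sphere (0 : Euc d) 1 =>
      Real.exp (-‖(z.1 : Euc d) - (z.2 : Euc d)‖ ^ 2 / (4 * ε)))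
      ((sphereMeasure d).prod (sphereMeasure d)) := by
    refine Integrable.of_bound (C := 1) (by fun_prop) (Filter.Eventually.of_forall fun z => ?_)
    rw [Real.norm_of_nonneg (Real.exp_pos _).le, Real.exp_le_one_iff]
    exact div_nonpos_of_nonpos_of_nonneg (by simp) (by positivity)
  rw [integral_prod _ hint]
  -- On the cap of radius `2√ε` about `θ` the Gaussian exponent is at least `-1`.
  have hin : ∀ θ : Metric.sphere (0 : Euc d) 1,
      Real.exp (-1) * (c0 * (√ε) ^ (d - 1)) ≤ ∫ ω : Metric.sphere (0 : Euc d) 1,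
        Real.exp (-‖(θ : Euc d) - (ω : Euc d)‖ ^ 2 / (4 * ε)) ∂(sphereMeasure d) := fun θ => by
    have hcap := sphereMeasure_ball_ge hd θ (Real.sqrt_pos.2 h0) (Real.sqrt_le_one.2 h1)
    calc _ ≤ Real.exp (-1) * (sphereMeasure d).real (Metric.ball θ (2 * √ε)) := by gcongr
      _ = ∫ ω, (Metric.ball θ (2 * √ε)).indicator (fun _ => Real.exp (-1)) ω
            ∂(sphereMeasure d) := by
          rw [integral_indicator_const _ measurableSet_ball, smul_eq_mul, mul_comm]
      _ ≤ _ := by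
          refine integral_mono_of_nonneg (Filter.Eventually.of_forall fun ω =>
            indicator_nonneg (fun _ _ => (Real.exp_pos _).le) _) ?_
            (Filter.Eventually.of_forall fun ω => ?_)
          · refine Integrable.of_bound (C := 1) (by fun_prop)
              (Filter.Eventually.of_forall fun ω => ?_)
            rw [Real.norm_of_nonneg (Real.exp_pos _).le, Real.exp_le_one_iff]
            exact div_nonpos_of_nonpos_of_nonneg (by simp) (by positivity)
          · by_cases hω : ω ∈ Metric.ball θ (2 * √ε)
            · simp only [indicator_of_mem hω]
              refine Real.exp_le_exp.2 ?_
              have h2 : ‖(θ : Euc d) - (ω : Euc d)‖ < 2 * √ε := by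
                rw [Metric.mem_ball, dist_comm, Subtype.dist_eq, dist_eq_norm] at hω
                exact hω
              have h3 : ‖(θ : Euc d) - (ω : Euc d)‖ ^ 2 ≤ 4 * ε := by
                calc _ ≤ (2 * √ε) ^ 2 := by gcongr
                  _ = 4 * ε := by rw [mul_pow, Real.sq_sqrt h0.le]; norm_num
              rw [le_div_iff₀ (by positivity)]
              linarith
            · simp only [indicator_of_notMem hω]
              exact (Real.exp_pos _).le
  have hpow : (√ε) ^ (d - 1) = ε ^ (((d : ℝ) - 1) / 2) := by
    rw [Real.sqrt_eq_rpow, ← Real.rpow_natCast, ← Real.rpow_mul h0.le, Nat.cast_sub hd]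
    congr 1
    push_cast
    ring
  rw [hpow] at hin
  calc _ = ∫ _ : Metric.sphere (0 : Euc d) 1, Real.exp (-1) * (c0 * ε ^ (((d : ℝ) - 1) / 2))
        ∂(sphereMeasure d) := by
        rw [integral_const, smul_eq_mul]; ring
    _ ≤ _ := integral_mono (integrable_const _) hint.integral_prod_left hin

/-- The Fourier transform of the surface measure of the sphere is not in `L^q` for
`2 < q < 2d/(d-1)`. -/
theorem lintegral_sphere_fourier_eq_top (hd : 1 ≤ d) {q : ℝ} (hq : 2 < q)
    (hqd : (d : ℝ) * (1 - 2 / q) < 1) :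
    ∫⁻ x : Euc d, ‖oscIntegral (sphereMeasure d) (fun θ => (θ : Euc d)) (fun _ => 1) x‖ₑ ^ q =
      ⊤ := by
  by_contra hA
  set g : Euc d → ℂ := oscIntegral (sphereMeasure d) (fun θ => (θ : Euc d)) (fun _ => 1) with hg
  set A := ∫⁻ x, ‖g x‖ₑ ^ q with hAdef
  obtain ⟨c, hc, hlow⟩ := integral_gaussian_sphere_ge hd
  have hone : Integrable (fun _ : Metric.sphere (0 : Euc d) 1 => (1 : ℂ)) (sphereMeasure d) :=
    integrable_const _
  have hgc : Continuous g := continuous_oscIntegral measurable_subtype_coe hone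
  have hgb : ∀ x, ‖g x‖ ≤ (sphereMeasure d).real univ := fun x => by
    have := enorm_oscIntegral_le (ν := sphereMeasure d) (fun θ => (θ : Euc d)) (fun _ => 1) x
    rw [← ofReal_norm] at this
    simp only [enorm_one, lintegral_one] at this
    exact (ENNReal.ofReal_le_iff_le_toReal (measure_ne_top _ _)).1 this
  have hconj : (q / 2).HolderConjugate (q / 2 / (q / 2 - 1)) :=
    Real.HolderConjugate.conjExponent (by linarith)
  set s := q / 2 / (q / 2 - 1) with hs
  have hs0 : 0 < s := div_pos (by linarith) (by linarith)
  have hs1 : 1 / s = 1 - 2 / q := by rw [hs]; field_simp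
  have hgauss : ∀ b : ℝ, 0 < b → Integrable fun x : Euc d => Real.exp (-b * ‖x‖ ^ 2) :=
    fun b hb => by
      have := (GaussianFourier.integrable_cexp_neg_mul_sq_norm_add (b := (b : ℂ))
        (by simpa using hb) 0 (0 : Euc d)).norm
      simpa [Complex.norm_exp, ← Complex.ofReal_pow] using this
  -- The regularized energy of `g` is bounded below through the cap estimate, by a multiple of
  -- `ε^(-1/2)`, and above through Hölder with exponents `q/2` and `s`, by a multiple of
  -- `ε^(-d/(2s))`.
  have hkey : ∀ ε : ℝ, 0 < ε → ε ≤ 1 →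
      (Real.pi / ε) ^ ((d : ℝ) / 2) * (c * ε ^ (((d : ℝ) - 1) / 2)) ≤
        (A ^ (2 / q)).toReal * ((Real.pi / (ε * s)) ^ ((d : ℝ) / 2)) ^ (1 / s) := by
    intro ε h0 h1
    have hid := integral_norm_sq_oscIntegral_mul_gaussian (ν := sphereMeasure d)
      (v := fun θ : Metric.sphere (0 : Euc d) 1 => (θ : Euc d)) measurable_subtype_coe hone h0
    simp only [map_one, one_mul] at hid
    rw [integral_complex_ofReal, integral_complex_ofReal, Complex.ofReal_inj, integral_const_mul,
      finrank_euclideanSpace_fin] at hid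
    have hint : Integrable fun x : Euc d => ‖g x‖ ^ 2 * Real.exp (-ε * ‖x‖ ^ 2) := by
      refine (hgauss ε h0).bdd_mul (c := (sphereMeasure d).real univ ^ 2) (by fun_prop)
        (Filter.Eventually.of_forall fun x => ?_)
      rw [norm_pow, norm_norm]
      gcongr
      exact hgb x
    have hL : ENNReal.ofReal (∫ x : Euc d, ‖g x‖ ^ 2 * Real.exp (-ε * ‖x‖ ^ 2)) =
        ∫⁻ x : Euc d, ((fun x : Euc d => ‖g x‖ₑ ^ (2 : ℝ)) *
          fun x : Euc d => ENNReal.ofReal (Real.exp (-ε * ‖x‖ ^ 2))) x := by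
      rw [ofReal_integral_eq_lintegral_ofReal hint
        (Filter.Eventually.of_forall fun t => by positivity)]
      refine lintegral_congr fun t => ?_
      rw [Pi.mul_apply, ENNReal.ofReal_mul (by positivity), ← ofReal_norm (g t),
        ENNReal.ofReal_rpow_of_nonneg (norm_nonneg _) (by norm_num), Real.rpow_two]
    have hH := ENNReal.lintegral_mul_le_Lp_mul_Lq (volume : Measure (Euc d)) hconj
      (f := fun x => ‖g x‖ₑ ^ (2 : ℝ)) (g := fun x => ENNReal.ofReal (Real.exp (-ε * ‖x‖ ^ 2)))
      (by fun_prop) (by fun_prop)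
    rw [← hL] at hH
    have e1 : ∀ x, (‖g x‖ₑ ^ (2 : ℝ)) ^ (q / 2) = ‖g x‖ₑ ^ q := fun x => by
      rw [← ENNReal.rpow_mul]; congr 1; ring
    have e2 : ∀ x : Euc d, ENNReal.ofReal (Real.exp (-ε * ‖x‖ ^ 2)) ^ s =
        ENNReal.ofReal (Real.exp (-(ε * s) * ‖x‖ ^ 2)) := fun x => by
      rw [ENNReal.ofReal_rpow_of_pos (Real.exp_pos _), ← Real.exp_mul]
      congr 2; ring
    simp_rw [e1, e2] at hH
    rw [← ofReal_integral_eq_lintegral_ofReal (hgauss _ (by positivity))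
      (Filter.Eventually.of_forall fun x => (Real.exp_pos _).le),
      GaussianFourier.integral_rexp_neg_mul_sq_norm (by positivity), finrank_euclideanSpace_fin,
      ENNReal.ofReal_rpow_of_nonneg (by positivity) (by positivity),
      show 1 / (q / 2) = 2 / q by field_simp] at hH
    have hAt : A ^ (2 / q) ≠ ⊤ := ENNReal.rpow_ne_top_of_nonneg (by positivity) hA
    have hH2 := ENNReal.toReal_mono (by finiteness) hH
    rw [ENNReal.toReal_ofReal (integral_nonneg fun x => by positivity), ENNReal.toReal_mul,
      ENNReal.toReal_ofReal (by positivity), hid] at hH2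
    exact (mul_le_mul_of_nonneg_left (hlow ε h0 h1) (by positivity)).trans hH2
  -- Here `η = (1 - d(1 - 2/q))/2 > 0`, so the two bounds contradict each other as `ε → 0`.
  set η : ℝ := 1 / 2 - (d : ℝ) / 2 * (1 / s) with hη
  have hη0 : 0 < η := by rw [hη, hs1]; linarith
  set B := (A ^ (2 / q)).toReal * ((Real.pi / s) ^ ((d : ℝ) / 2)) ^ (1 / s) with hB
  set D := Real.pi ^ ((d : ℝ) / 2) * c with hD
  have hD0 : 0 < D := by positivity
  have hkey2 : ∀ ε : ℝ, 0 < ε → ε ≤ 1 → D ≤ B * ε ^ η := by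
    intro ε h0 h1
    have h := hkey ε h0 h1
    have e1 : (Real.pi / ε) ^ ((d : ℝ) / 2) * (c * ε ^ (((d : ℝ) - 1) / 2)) =
        D * ε ^ (-(1 / 2) : ℝ) := by
      rw [Real.div_rpow Real.pi_pos.le h0.le, div_eq_mul_inv, ← Real.rpow_neg h0.le, hD,
        show (-(1 / 2) : ℝ) = -((d : ℝ) / 2) + ((d : ℝ) - 1) / 2 by ring, Real.rpow_add h0]
      ring
    have e2 : ((Real.pi / (ε * s)) ^ ((d : ℝ) / 2)) ^ (1 / s) =
        ((Real.pi / s) ^ ((d : ℝ) / 2)) ^ (1 / s) * ε ^ (-((d : ℝ) / 2 * (1 / s))) := by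
      rw [mul_comm ε s, ← div_div, Real.div_rpow (by positivity) h0.le,
        Real.div_rpow (by positivity) (by positivity), ← Real.rpow_mul h0.le,
        Real.rpow_neg h0.le, div_eq_mul_inv]
    rw [e1, e2, ← mul_assoc, ← hB] at h
    have h3 := mul_le_mul_of_nonneg_right h (Real.rpow_nonneg h0.le (1 / 2))
    rw [mul_assoc D, ← Real.rpow_add h0, mul_assoc B, ← Real.rpow_add h0, neg_add_cancel,
      Real.rpow_zero, mul_one] at h3
    refine h3.trans (le_of_eq ?_)
    rw [hη]; ring_nf
  have hlim : Filter.Tendsto (fun n : ℕ => B * (1 / ((n : ℝ) + 1)) ^ η) Filter.atTop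
      (nhds (B * 0)) := by
    refine Filter.Tendsto.const_mul _ ?_
    have := (tendsto_one_div_add_atTop_nhds_zero_nat (𝕜 := ℝ)).rpow_const (p := η) (Or.inr hη0.le)
    rwa [Real.zero_rpow hη0.ne'] at this
  rw [mul_zero] at hlim
  have := ge_of_tendsto' hlim (fun n : ℕ => hkey2 (1 / ((n : ℝ) + 1)) (by positivity)
    (by rw [div_le_one (by positivity)]; linarith [n.cast_nonneg (α := ℝ)]))
  linarith

/-- Test the estimate on the constant function, whose extension is the Fourier transform of `σ`. -/
theorem SphereExtensionBounded.le_exponent (hd : 2 ≤ d) {p : ℝ≥0∞} {q : ℝ} (hq : 1 ≤ q)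
    (h : SphereExtensionBounded d p (ENNReal.ofReal q)) : 2 * (d : ℝ) / (d - 1) ≤ q := by
  obtain ⟨C, hC⟩ := h
  have hd' : (2 : ℝ) ≤ d := by exact_mod_cast hd
  by_contra! hlt
  have h1 := hC (fun _ => 1) (memLp_const 1)
  have hg : sphereExtension (fun _ : Metric.sphere (0 : Euc d) 1 => (1 : ℂ)) =
      oscIntegral (sphereMeasure d) (fun θ => (θ : Euc d)) (fun _ => 1) := rfl
  set g := oscIntegral (sphereMeasure d) (fun θ => (θ : Euc d)) (fun _ => 1) with hgdef
  have hq0 : (0 : ℝ) < q := by linarith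
  have hfin : ∫⁻ x, ‖g x‖ₑ ^ q < ⊤ := by
    have h2 : eLpNorm g (ENNReal.ofReal q) volume < ⊤ := by
      rw [hg] at h1
      refine h1.trans_lt (ENNReal.mul_lt_top ENNReal.coe_lt_top
        (memLp_const (μ := sphereMeasure d) (1 : ℂ)).2)
    have h3 := lintegral_rpow_enorm_lt_top_of_eLpNorm_lt_top
      (by simpa using hq0) ENNReal.ofReal_ne_top h2
    rwa [ENNReal.toReal_ofReal hq0.le] at h3
  have h2d : 2 < 2 * (d : ℝ) / (d - 1) := by rw [lt_div_iff₀ (by linarith)]; linarith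
  -- The exponent `q` may be at most `2`, where the divergence lemma does not apply. Since `g` is
  -- bounded, being in `L^q` implies being in `L^(q1)` for the larger `q1`.
  obtain ⟨q1, hq1, hq1'⟩ := exists_between (max_lt h2d hlt)
  have hq2 : 2 < q1 := (le_max_left _ _).trans_lt hq1
  have hqq : q < q1 := (le_max_right _ _).trans_lt hq1
  have htop := lintegral_sphere_fourier_eq_top (d := d) (by lia) hq2 (by
    rw [lt_div_iff₀ (by linarith)] at hq1'
    rw [one_sub_div (by linarith), mul_div_assoc', div_lt_one (by linarith)]
    linarith)
  refine absurd htop (ne_of_lt ?_)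
  have hgb : ∀ x, ‖g x‖ₑ ≤ sphereMeasure d univ := fun x => by
    simpa using enorm_oscIntegral_le (ν := sphereMeasure d) (fun θ => (θ : Euc d)) (fun _ => 1) x
  calc ∫⁻ x, ‖g x‖ₑ ^ q1 ≤ ∫⁻ x, (sphereMeasure d univ) ^ (q1 - q) * ‖g x‖ₑ ^ q := by
        refine lintegral_mono fun x => ?_
        rw [show q1 = (q1 - q) + q by ring, ENNReal.rpow_add_of_nonneg _ _ (by linarith) hq0.le,
          sub_add_cancel]
        gcongr
        exact hgb x
    _ < ⊤ := by
        have : (sphereMeasure d univ) ^ (q1 - q) ≠ ⊤ :=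
          ENNReal.rpow_ne_top_of_nonneg (by linarith) (measure_ne_top _ _)
        rw [lintegral_const_mul' _ _ this]
        exact ENNReal.mul_lt_top this.lt_top hfin

end SphereFourier

/-! ### Radial slices of the extension and the scaled sphere estimate. -/

section Slices

variable {d : ℕ}

/-- The contribution of the sphere of radius `r` to the extension of `F`. -/
def radialSlice (F : Euc d → ℂ) (x : Euc d) (r : ℝ) : ℂ :=
  (r : ℂ) ^ (d - 2) * sphereExtension (fun θ => F (r • (θ : Euc d))) (r • x)

/-- The mass of `|F| ^ p` on the sphere of radius `r`. -/
def radialMass (p : ℝ) (F : Euc d → ℂ) (r : ℝ) : ℝ≥0∞ :=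
  ENNReal.ofReal (r ^ (d - 2)) * ∫⁻ θ, ‖F (r • (θ : Euc d))‖ₑ ^ p ∂(sphereMeasure d)

theorem ae_pos_hyperbolicRadialMeasure : ∀ᵐ r ∂hyperbolicRadialMeasure, 0 < r :=
  (withDensity_absolutelyContinuous _ _).ae_le (ae_restrict_mem measurableSet_Ioi)

theorem measurable_radialMass {p : ℝ} {F : Euc d → ℂ} (hF : Continuous F) :
    Measurable (radialMass p F) := by
  unfold radialMass
  have hFm := hF.measurable
  refine Measurable.mul (by fun_prop) ?_
  exact Measurable.lintegral_prod_right' (f := fun z : ℝ × Metric.sphere (0 : Euc d) 1 =>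
    ‖F (z.1 • (z.2 : Euc d))‖ₑ ^ p) (by fun_prop)

theorem continuous_radialSlice {F : Euc d → ℂ} (hF : Continuous F) {M : ℝ} (hM : ∀ ξ, ‖F ξ‖ ≤ M) :
    Continuous fun z : Euc d × ℝ => radialSlice F z.1 z.2 := by
  unfold radialSlice sphereExtension
  refine Continuous.mul (by fun_prop) ?_
  refine continuous_of_dominated (bound := fun _ => M)
    (fun z => Continuous.aestronglyMeasurable (by fun_prop))
    (fun z => Filter.Eventually.of_forall fun θ => ?_) (integrable_const _)
    (Filter.Eventually.of_forall fun θ => by fun_prop)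
  rw [norm_mul, norm_cexp_I_mul_ofReal, one_mul]
  exact hM _

theorem norm_radialSlice_le {F : Euc d → ℂ} {M R : ℝ} (hM : ∀ ξ, ‖F ξ‖ ≤ M)
    (hR : ∀ ξ, R < ‖ξ‖ → F ξ = 0) (x : Euc d) {r : ℝ} (hr : 0 < r) :
    ‖radialSlice F x r‖ ≤
      ‖(Ioc 0 R).indicator (fun _ => R ^ (d - 2) * (M * (sphereMeasure d).real univ)) r‖ := by
  have hM0 : 0 ≤ M := (norm_nonneg _).trans (hM 0)
  have hS : ‖sphereExtension (fun θ => F (r • (θ : Euc d))) (r • x)‖ ≤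
      M * (sphereMeasure d).real univ := by
    refine norm_integral_le_of_norm_le_const (Filter.Eventually.of_forall fun θ => ?_)
    rw [norm_mul, norm_cexp_I_mul_ofReal, one_mul]
    exact hM _
  by_cases hrR : r ≤ R
  · rw [indicator_of_mem (show r ∈ Ioc 0 R from ⟨hr, hrR⟩), Real.norm_of_nonneg (by
      have : 0 ≤ R := hr.le.trans hrR
      positivity), radialSlice, norm_mul, norm_pow, Complex.norm_real, Real.norm_of_nonneg hr.le]
    have : 0 ≤ R := hr.le.trans hrR
    gcongr
  · have hz : ∀ θ : Metric.sphere (0 : Euc d) 1, F (r • (θ : Euc d)) = 0 := fun θ => by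
      refine hR _ ?_
      rw [norm_smul, Real.norm_of_nonneg hr.le]
      simpa using hrR
    simp [radialSlice, sphereExtension, hz]

theorem memLp_radialSlice {F : Euc d → ℂ} (hF : Continuous F) {M R : ℝ} (hM : ∀ ξ, ‖F ξ‖ ≤ M)
    (hR : ∀ ξ, R < ‖ξ‖ → F ξ = 0) (x : Euc d) (p : ℝ≥0∞) :
    MemLp (radialSlice F x) p hyperbolicRadialMeasure := by
  have hc := (continuous_radialSlice hF hM).comp (Continuous.prodMk_right x)
  refine (memLp_indicator_const (μ := hyperbolicRadialMeasure) p (measurableSet_Ioc (a := (0 : ℝ))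
    (b := R)) (R ^ (d - 2) * (M * (sphereMeasure d).real univ)) (Or.inr ?_)).mono
      hc.aestronglyMeasurable ?_
  · refine ne_top_of_le_ne_top ?_ ((hyperbolicRadialMeasure_le _).trans
      (Measure.restrict_apply_le _ _))
    simp
  · filter_upwards [ae_pos_hyperbolicRadialMeasure] with r hr
    exact norm_radialSlice_le hM hR x hr

/-- Allows the radial integral to be restricted to `B ≠ 0`, where the weight can divide by `B`. -/
theorem radialSlice_eq_zero {F : Euc d → ℂ} (hF : Continuous F) {p : ℝ} (hp : 0 < p) {r : ℝ}
    (hr : 0 < r) (h0 : radialMass p F r = 0) (x : Euc d) : radialSlice F x r = 0 := by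
  have h1 : ∫⁻ θ, ‖F (r • (θ : Euc d))‖ₑ ^ p ∂(sphereMeasure d) = 0 := by
    rcases mul_eq_zero.1 h0 with h | h
    · rw [ENNReal.ofReal_eq_zero] at h
      exact absurd (pow_pos hr (d - 2)) (not_lt.2 h)
    · exact h
  have hFm := hF.measurable
  rw [lintegral_eq_zero_iff (by fun_prop)] at h1
  rw [radialSlice, sphereExtension, integral_eq_zero_of_ae, mul_zero]
  filter_upwards [h1] with θ hθ
  have : ‖F (r • (θ : Euc d))‖ₑ = 0 := by
    simpa [ENNReal.rpow_eq_zero_iff, hp, hp.not_gt] using hθ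
  rw [enorm_eq_zero] at this
  simp [this]

theorem radialMass_ne_top {F : Euc d → ℂ} {M : ℝ} (hM : ∀ ξ, ‖F ξ‖ ≤ M) {p : ℝ} (hp : 0 < p)
    (r : ℝ) : radialMass p F r ≠ ⊤ := by
  refine ENNReal.mul_ne_top ENNReal.ofReal_ne_top (ne_top_of_le_ne_top
    (b := ENNReal.ofReal M ^ p * sphereMeasure d univ) ?_ ?_)
  · exact ENNReal.mul_ne_top (ENNReal.rpow_ne_top_of_nonneg hp.le ENNReal.ofReal_ne_top)
      (measure_ne_top _ _)
  · rw [← lintegral_const]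
    refine lintegral_mono fun θ => ENNReal.rpow_le_rpow ?_ hp.le
    rw [← ofReal_norm]
    exact ENNReal.ofReal_le_ofReal (hM _)

theorem lintegral_comp_smul_euc {r : ℝ} (hr : 0 < r) {g : Euc d → ℝ≥0∞} (hg : Measurable g) :
    ∫⁻ x, g (r • x) = ENNReal.ofReal (r ^ (-(d : ℝ))) * ∫⁻ x, g x := by
  have h := Measure.map_addHaar_smul (volume : Measure (Euc d)) hr.ne'
  rw [← lintegral_map hg (measurable_const_smul r), h, lintegral_smul_measure,
    finrank_euclideanSpace_fin, abs_of_nonneg (by positivity), Real.rpow_neg hr.le,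
    Real.rpow_natCast, smul_eq_mul]

/-- The sphere estimate for `θ ↦ F(rθ)`, with the dilation `x ↦ r x` contributing `r^(-d)`. -/
theorem lintegral_radialSlice_rpow_le (hd : 2 ≤ d) {p q κ : ℝ} (hp : 0 < p) (hq : 0 < q)
    (hκ : κ = 2 / (d - 1)) (hpq : q / p = q - 1 - κ) {C : ℝ≥0}
    (hC : ∀ f : Metric.sphere (0 : Euc d) 1 → ℂ, MemLp f (ENNReal.ofReal p) (sphereMeasure d) →
      eLpNorm (sphereExtension f) (ENNReal.ofReal q) volume ≤
        C * eLpNorm f (ENNReal.ofReal p) (sphereMeasure d))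
    {F : Euc d → ℂ} (hF : Continuous F) {M : ℝ} (hM : ∀ ξ, ‖F ξ‖ ≤ M) {r : ℝ} (hr : 0 < r) :
    ∫⁻ x, ‖radialSlice F x r‖ₑ ^ q ≤
      (C : ℝ≥0∞) ^ q * ENNReal.ofReal (r ^ (-κ)) * radialMass p F r ^ (q / p) := by
  set f : Metric.sphere (0 : Euc d) 1 → ℂ := fun θ => F (r • (θ : Euc d)) with hf
  have hfc : Continuous f := by fun_prop
  have hfm : MemLp f (ENNReal.ofReal p) (sphereMeasure d) :=
    MemLp.of_bound hfc.aestronglyMeasurable M (Filter.Eventually.of_forall fun θ => hM _)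
  have hsc : Continuous (sphereExtension f) := continuous_oscIntegral
    (ν := sphereMeasure d) (v := fun θ => (θ : Euc d)) measurable_subtype_coe
    (Integrable.of_bound hfc.aestronglyMeasurable M (Filter.Eventually.of_forall fun θ => hM _))
  have h1 := ENNReal.rpow_le_rpow (hC f hfm) hq.le
  rw [eLpNorm_eq_lintegral_rpow_enorm_toReal (by simpa using hq) ENNReal.ofReal_ne_top,
    eLpNorm_eq_lintegral_rpow_enorm_toReal (by simpa using hp) ENNReal.ofReal_ne_top,
    ENNReal.toReal_ofReal hq.le, ENNReal.toReal_ofReal hp.le,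
    ENNReal.mul_rpow_of_nonneg _ _ hq.le, ← ENNReal.rpow_mul, ← ENNReal.rpow_mul,
    one_div_mul_cancel hq.ne', ENNReal.rpow_one, one_div_mul_eq_div] at h1
  have h2 : ∀ x, ‖radialSlice F x r‖ₑ ^ q =
      ENNReal.ofReal (r ^ (((d : ℝ) - 2) * q)) * ‖sphereExtension f (r • x)‖ₑ ^ q := fun x => by
    rw [radialSlice, enorm_mul, ENNReal.mul_rpow_of_nonneg _ _ hq.le, ← ofReal_norm (_ ^ _),
      norm_pow, Complex.norm_real, Real.norm_of_nonneg hr.le,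
      ENNReal.ofReal_rpow_of_pos (by positivity), ← Real.rpow_natCast, ← Real.rpow_mul hr.le,
      Nat.cast_sub hd, Nat.cast_ofNat]
  simp_rw [h2]
  have hsm := hsc.measurable
  rw [lintegral_const_mul _ (by fun_prop), lintegral_comp_smul_euc hr
    (g := fun x => ‖sphereExtension f x‖ₑ ^ q) (by fun_prop), radialMass,
    ENNReal.mul_rpow_of_nonneg _ _ (by positivity), ENNReal.ofReal_rpow_of_pos (by positivity),
    ← Real.rpow_natCast, ← Real.rpow_mul hr.le, Nat.cast_sub hd, Nat.cast_ofNat]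
  have hd1 : (d : ℝ) - 1 ≠ 0 := by
    have : (2 : ℝ) ≤ d := by exact_mod_cast hd
    linarith
  calc _ ≤ ENNReal.ofReal (r ^ (((d : ℝ) - 2) * q)) * (ENNReal.ofReal (r ^ (-(d : ℝ))) *
        ((C : ℝ≥0∞) ^ q * (∫⁻ θ, ‖f θ‖ₑ ^ p ∂(sphereMeasure d)) ^ (q / p))) := by gcongr
    _ = (C : ℝ≥0∞) ^ q * (ENNReal.ofReal (r ^ (((d : ℝ) - 2) * q)) *
        ENNReal.ofReal (r ^ (-(d : ℝ)))) *
          (∫⁻ θ, ‖f θ‖ₑ ^ p ∂(sphereMeasure d)) ^ (q / p) := by ring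
    _ = (C : ℝ≥0∞) ^ q * (ENNReal.ofReal (r ^ (-κ)) *
        ENNReal.ofReal (r ^ (((d : ℝ) - 2) * (q / p)))) *
          (∫⁻ θ, ‖f θ‖ₑ ^ p ∂(sphereMeasure d)) ^ (q / p) := by
        -- Power count: with `q/p = q - 1 - κ`, `(d-2)q - d - (d-2)q/p = (d-2)(1 + κ) - d = -κ`, by
        -- `κ = 2/(d-1)`.
        congr 2
        rw [← ENNReal.ofReal_mul (by positivity), ← ENNReal.ofReal_mul (by positivity),
          ← Real.rpow_add hr, ← Real.rpow_add hr, hpq]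
        congr 2
        rw [hκ]
        field_simp
        ring
    _ = _ := by ring

theorem lintegral_radialMass (hd : 2 ≤ d) {p : ℝ} {f : hyperboloid d → ℂ} (hf : Continuous f) :
    ∫⁻ r, radialMass p (f ∘ hyperboloidPoint) r ∂hyperbolicRadialMeasure =
      ∫⁻ z, ‖f z‖ₑ ^ p ∂(lorentzMeasure d) := by
  have hc : Continuous (hyperboloidPoint ∘ polarPoint (d := d)) :=
    continuous_hyperboloidPoint.comp continuous_polarPoint
  have hm : Measurable fun z : Metric.sphere (0 : Euc d) 1 × ℝ =>
      ‖f ((hyperboloidPoint ∘ polarPoint) z)‖ₑ ^ p := by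
    have := hf.comp hc
    exact this.measurable.enorm.pow_const p
  rw [lorentzMeasure_eq_map hd, lintegral_map (by fun_prop) hc.measurable,
    lintegral_prod_symm' _ hm, lintegral_withDensity_eq_lintegral_mul _ (by fun_prop)
      (hm.lintegral_prod_left')]
  rfl

theorem integrable_hyperboloidExtension {f : hyperboloid d → ℂ}
    (hf : Integrable f (lorentzMeasure d)) (y : ℝ × Euc d) : Integrable (fun z : hyperboloid d =>
      Complex.exp (Complex.I * ((y.1 * z.1.1 + inner ℝ y.2 z.1.2 : ℝ) : ℂ)) * f z)
      (lorentzMeasure d) :=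
  hf.bdd_mul (c := 1) (Continuous.aestronglyMeasurable (by fun_prop))
    (Filter.Eventually.of_forall fun _ => (norm_cexp_I_mul_ofReal _).le)

theorem continuous_hyperboloidExtension {f : hyperboloid d → ℂ}
    (hf : Integrable f (lorentzMeasure d)) : Continuous (hyperboloidExtension f) := by
  unfold hyperboloidExtension
  refine continuous_of_dominated (bound := fun z => ‖f z‖)
    (fun y => (integrable_hyperboloidExtension hf y).1)
    (fun y => Filter.Eventually.of_forall fun z => ?_) hf.norm
    (Filter.Eventually.of_forall fun z => by fun_prop)
  rw [norm_mul, norm_cexp_I_mul_ofReal, one_mul]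

/-- Fubini in polar coordinates: the phase `t√(r² + 1)` does not depend on `θ`, so the angular
integral is exactly the sphere extension at `r x`. -/
theorem hyperboloidExtension_eq_oscIntegral (hd : 2 ≤ d) {f : hyperboloid d → ℂ}
    (hf : Integrable f (lorentzMeasure d)) (t : ℝ) (x : Euc d) :
    hyperboloidExtension f (t, x) = oscIntegral hyperbolicRadialMeasure
      (fun r => √(r ^ 2 + 1)) (radialSlice (f ∘ hyperboloidPoint) x) t := by
  have hc : Continuous (hyperboloidPoint ∘ polarPoint (d := d)) :=
    continuous_hyperboloidPoint.comp continuous_polarPoint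
  have hint := integrable_hyperboloidExtension hf (t, x)
  rw [hyperboloidExtension]
  rw [lorentzMeasure_eq_map hd] at hint ⊢
  rw [integral_map hc.measurable.aemeasurable hint.1, integral_prod_symm _
    (show Integrable (fun z => Complex.exp (Complex.I * ((t *
      ((hyperboloidPoint ∘ polarPoint) z : hyperboloid d).1.1 +
        inner ℝ x ((hyperboloidPoint ∘ polarPoint) z : hyperboloid d).1.2 : ℝ) : ℂ)) *
          f ((hyperboloidPoint ∘ polarPoint) z)) _ from
      (integrable_map_measure hint.1 hc.measurable.aemeasurable).1 hint),
    integral_withDensity_eq_integral_toReal_smul (by fun_prop)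
      (Filter.Eventually.of_forall fun _ => ENNReal.ofReal_lt_top), oscIntegral]
  refine integral_congr_ae ?_
  filter_upwards [ae_pos_hyperbolicRadialMeasure] with r hr
  rw [ENNReal.toReal_ofReal (by positivity), radialSlice, sphereExtension, Complex.real_smul,
    Complex.ofReal_pow, mul_left_comm]
  congr 1
  rw [← integral_const_mul]
  refine integral_congr_ae (Filter.Eventually.of_forall fun θ => ?_)
  simp only [Function.comp_apply]
  rw [← mul_assoc, ← Complex.exp_add, ← mul_add, ← Complex.ofReal_add]
  simp only [hyperboloidPoint, bracket_polarPoint]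
  congr 4
  simp [polarPoint, real_inner_smul_left, real_inner_smul_right, mul_comm]
  exact (bracket_polarPoint (θ, r)).symm

end Slices

/-! ### The data-dependent weight and the a priori estimate. -/

section MainEstimate

variable {d : ℕ}

theorem le_or_le_of_rpow_mul_rpow_le {a b s α : ℝ} (ha : 0 < a) (hb : 0 < b) (h0 : 0 ≤ α)
    (h1 : α ≤ 1) (h : a ^ α * b ^ (1 - α) ≤ s) : a ≤ s ∨ b ≤ s := by
  rcases le_total a b with hab | hab
  · refine Or.inl (le_trans ?_ h)
    calc a = a ^ α * a ^ (1 - α) := by rw [← Real.rpow_add ha]; simp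
      _ ≤ _ := by gcongr
  · refine Or.inr (le_trans ?_ h)
    calc b = b ^ α * b ^ (1 - α) := by rw [← Real.rpow_add hb]; simp
      _ ≤ _ := by gcongr

open Classical in
/-- The weight `r ^ α (N / B(r)) ^ (1 - α)` on the set where `r` and the density `B` are positive,
extended by `1`. -/
def mixedWeight (α : ℝ) (B : ℝ → ℝ≥0∞) (N : ℝ) (r : ℝ) : ℝ :=
  if 0 < r ∧ B r ≠ 0 then r ^ α * (N / (B r).toReal) ^ (1 - α) else 1

theorem measurableSet_pos_and_ne_zero {B : ℝ → ℝ≥0∞} (hB : Measurable B) :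
    MeasurableSet {r : ℝ | 0 < r ∧ B r ≠ 0} :=
  measurableSet_Ioi.inter (hB (measurableSet_singleton 0).compl)

theorem measurable_mixedWeight (α : ℝ) {B : ℝ → ℝ≥0∞} (hB : Measurable B) (N : ℝ) :
    Measurable (mixedWeight α B N) := by
  unfold mixedWeight
  exact Measurable.ite (measurableSet_pos_and_ne_zero hB) (by fun_prop) measurable_const

theorem mixedWeight_pos {α : ℝ} {B : ℝ → ℝ≥0∞} (hBt : ∀ r, B r ≠ ⊤) {N : ℝ} (hN : 0 < N)
    (r : ℝ) : 0 < mixedWeight α B N r := by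
  unfold mixedWeight
  split_ifs with h
  · have := ENNReal.toReal_pos h.2 (hBt r)
    have := h.1
    positivity
  · exact one_pos

/-- If the geometric mean of `r` and `N/B(r)` is at most `s`, one of the two is. The set `r ≤ s` has
mass at most `s` because the radial density is at most `1`, and `B ≥ N/s` has mass at most `s` by
Markov; hence the constant `2`. -/
theorem measure_mixedWeight_le {α : ℝ} (h0 : 0 ≤ α) (h1 : α ≤ 1) {B : ℝ → ℝ≥0∞}
    (hB : Measurable B) (hBt : ∀ r, B r ≠ ⊤) {N : ℝ} (hN : 0 < N)
    (hBN : ∫⁻ r, B r ∂hyperbolicRadialMeasure = ENNReal.ofReal N) {s : ℝ} (hs : 0 < s) :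
    hyperbolicRadialMeasure.restrict {r : ℝ | 0 < r ∧ B r ≠ 0} {r | mixedWeight α B N r ≤ s} ≤
      2 * ENNReal.ofReal s := by
  have hS := measurableSet_pos_and_ne_zero hB
  have hsub : {r | mixedWeight α B N r ≤ s} ∩ {r : ℝ | 0 < r ∧ B r ≠ 0} ⊆
      Ioc 0 s ∪ {r | ENNReal.ofReal (N / s) ≤ B r} := by
    rintro r ⟨hr1, hr2⟩
    have hBp := ENNReal.toReal_pos hr2.2 (hBt r)
    have hr1' : mixedWeight α B N r ≤ s := hr1
    rw [mixedWeight, if_pos (show 0 < r ∧ B r ≠ 0 from hr2)] at hr1'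
    rcases le_or_le_of_rpow_mul_rpow_le hr2.1 (by positivity) h0 h1 hr1' with h | h
    · exact Or.inl ⟨hr2.1, h⟩
    · refine Or.inr ?_
      rw [div_le_iff₀ hBp] at h
      refine (ENNReal.ofReal_le_iff_le_toReal (hBt r)).2 ?_
      rw [div_le_iff₀ hs]
      linarith
  rw [Measure.restrict_apply (measurableSet_le (measurable_mixedWeight α hB N) measurable_const)]
  refine (measure_mono hsub).trans ((measure_union_le _ _).trans ?_)
  rw [two_mul]
  refine add_le_add ?_ ?_
  · refine (hyperbolicRadialMeasure_le _).trans ((Measure.restrict_apply_le _ _).trans ?_)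
    simp
  · have hmk := mul_meas_ge_le_lintegral hB (μ := hyperbolicRadialMeasure) (ENNReal.ofReal (N / s))
    rw [hBN] at hmk
    have hNs : 0 < N / s := by positivity
    have h2 : hyperbolicRadialMeasure {r | ENNReal.ofReal (N / s) ≤ B r} ≤
        ENNReal.ofReal N / ENNReal.ofReal (N / s) :=
      (ENNReal.le_div_iff_mul_le (Or.inl (ENNReal.ofReal_pos.2 hNs).ne')
        (Or.inl ENNReal.ofReal_ne_top)).2 (by rw [mul_comm]; exact hmk)
    refine h2.trans (le_of_eq ?_)
    rw [← ENNReal.ofReal_div_of_pos hNs]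
    congr 1
    field_simp

theorem lintegral_hyperboloidExtension_rpow_le (hd : 2 ≤ d) {p q κ : ℝ} (hp : 0 < p) (hq : 2 < q)
    (hκ : κ = 2 / (d - 1)) (hκq : κ ≤ q - 2) (hpq : q / p = q - 1 - κ) {C : ℝ≥0}
    (hC : ∀ f : Metric.sphere (0 : Euc d) 1 → ℂ, MemLp f (ENNReal.ofReal p) (sphereMeasure d) →
      eLpNorm (sphereExtension f) (ENNReal.ofReal q) volume ≤
        C * eLpNorm f (ENNReal.ofReal p) (sphereMeasure d))
    {f : hyperboloid d → ℂ} (hf : Continuous f) (hfc : HasCompactSupport f) :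
    ∫⁻ y, ‖hyperboloidExtension f y‖ₑ ^ q ≤
      (paleyConst q 2 (ENNReal.ofReal (2 * Real.pi)) * (C : ℝ≥0∞) ^ q) *
        (∫⁻ z, ‖f z‖ₑ ^ p ∂(lorentzMeasure d)) ^ (q / p) := by
  have hq0 : 0 < q := by linarith
  have hκ0 : 0 < κ := by
    have : (2 : ℝ) ≤ d := by exact_mod_cast hd
    rw [hκ]
    exact div_pos two_pos (by linarith)
  set F : Euc d → ℂ := f ∘ hyperboloidPoint with hFdef
  have hF : Continuous F := hf.comp continuous_hyperboloidPoint
  obtain ⟨M, hM'⟩ := hf.bounded_above_of_compact_support hfc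
  have hM : ∀ ξ, ‖F ξ‖ ≤ M := fun ξ => hM' _
  obtain ⟨R, hR⟩ : ∃ R : ℝ, ∀ ξ, R < ‖ξ‖ → F ξ = 0 := by
    have hbdd := (hfc.isCompact.image (f := fun z : hyperboloid d => z.1.2)
      (by fun_prop)).isBounded
    obtain ⟨R, hR⟩ := hbdd.exists_norm_le
    refine ⟨R, fun ξ hξ => ?_⟩
    by_contra hne
    exact absurd (hR ξ ⟨hyperboloidPoint ξ, subset_tsupport _ hne, rfl⟩) (not_le.2 hξ)
  set B := radialMass p F with hBdef
  have hBm : Measurable B := measurable_radialMass hF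
  have hBt : ∀ r, B r ≠ ⊤ := radialMass_ne_top hM hp
  have hBN : ∫⁻ r, B r ∂hyperbolicRadialMeasure = ∫⁻ z, ‖f z‖ₑ ^ p ∂(lorentzMeasure d) :=
    lintegral_radialMass hd hf
  have hNt : ∫⁻ z, ‖f z‖ₑ ^ p ∂(lorentzMeasure d) ≠ ⊤ := by
    have := lintegral_rpow_enorm_lt_top_of_eLpNorm_lt_top (by simpa using hp)
      ENNReal.ofReal_ne_top (memLp_hyperboloid (ENNReal.ofReal p) f hf hfc).2
    rw [ENNReal.toReal_ofReal hp.le] at this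
    exact this.ne
  set S : Set ℝ := {r : ℝ | 0 < r ∧ B r ≠ 0} with hS
  have hSm : MeasurableSet S := measurableSet_pos_and_ne_zero hBm
  have hfi : Integrable f (lorentzMeasure d) :=
    memLp_one_iff_integrable.1 (memLp_hyperboloid 1 f hf hfc)
  have hext : ∀ t x, hyperboloidExtension f (t, x) =
      oscIntegral (hyperbolicRadialMeasure.restrict S) (fun r => √(r ^ 2 + 1))
        (radialSlice F x) t := fun t x => by
    rw [hyperboloidExtension_eq_oscIntegral hd hfi, oscIntegral, oscIntegral,
      ← integral_indicator hSm]
    refine integral_congr_ae ?_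
    filter_upwards [ae_pos_hyperbolicRadialMeasure] with r hr
    by_cases hrS : r ∈ S
    · rw [indicator_of_mem hrS]
    · rw [indicator_of_notMem hrS]
      have : B r = 0 := by
        by_contra h
        exact hrS ⟨hr, h⟩
      rw [radialSlice_eq_zero hF hp hr this, mul_zero]
  have hEc : Continuous (hyperboloidExtension f) := continuous_hyperboloidExtension hfi
  have hEm : Measurable fun y => ‖hyperboloidExtension f y‖ₑ ^ q := by
    have := hEc.measurable
    fun_prop
  -- The weight requires `N > 0`; if `N = 0`, then `S` is null and the extension vanishes
  -- identically.
  rcases eq_or_ne (∫⁻ z, ‖f z‖ₑ ^ p ∂(lorentzMeasure d)) 0 with hN0 | hN0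
  · have hSnull : hyperbolicRadialMeasure.restrict S = 0 := by
      rw [Measure.restrict_eq_zero]
      rw [hN0, lintegral_eq_zero_iff hBm] at hBN
      refine measure_mono_null (fun r hr => hr.2) hBN
    have : ∀ y, hyperboloidExtension f y = 0 := fun y => by
      rw [← Prod.mk.eta (p := y), hext, hSnull, oscIntegral, integral_zero_measure]
    simp [this, hq0]
  set N := (∫⁻ z, ‖f z‖ₑ ^ p ∂(lorentzMeasure d)).toReal with hN
  have hNp : 0 < N := ENNReal.toReal_pos hN0 hNt
  have hNe : ∫⁻ z, ‖f z‖ₑ ^ p ∂(lorentzMeasure d) = ENNReal.ofReal N :=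
    (ENNReal.ofReal_toReal hNt).symm
  rw [hNe] at hBN ⊢
  set α := κ / (q - 2) with hα
  have hα0 : 0 ≤ α := div_nonneg hκ0.le (by linarith)
  have hα1 : α ≤ 1 := (div_le_one (by linarith)).2 hκq
  set ψ := mixedWeight α B N with hψ
  have hψm : Measurable ψ := measurable_mixedWeight α hBm N
  have hkc := continuous_radialSlice hF hM
  have hkcx : ∀ x, Measurable (radialSlice F x) := fun x =>
    (hkc.comp (Continuous.prodMk_right x)).measurable
  have hkj : Measurable fun z : Euc d × ℝ =>
      ‖radialSlice F z.1 z.2‖ₑ ^ q * ENNReal.ofReal (ψ z.2 ^ (q - 2)) := by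
    have := hkc.measurable
    fun_prop
  set P := paleyConst q 2 (ENNReal.ofReal (2 * Real.pi)) with hP
  have hslice : ∀ x : Euc d, ∫⁻ t : ℝ, ‖hyperboloidExtension f (t, x)‖ₑ ^ q ≤
      P * ∫⁻ r in S, ‖radialSlice F x r‖ₑ ^ q * ENNReal.ofReal (ψ r ^ (q - 2))
        ∂hyperbolicRadialMeasure := fun x => by
    simp_rw [hext]
    exact lintegral_oscIntegral_rpow_le hSm hψm (mixedWeight_pos hBt hNp)
      (fun s hs => measure_mixedWeight_le hα0 hα1 hBm hBt hNp hBN hs) hq (hkcx x)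
      (memLp_one_iff_integrable.1 (memLp_radialSlice hF hM hR x 1)).restrict
      ((memLp_radialSlice hF hM hR x 2).restrict S)
  -- The choice of `α` turns `ψ^(q-2)` into `r^κ (N/B)^(q/p-1)`, which cancels `r^(-κ)` and lowers
  -- `B^(q/p)` to `B`.
  have hweight : ∀ r ∈ S, (∫⁻ x, ‖radialSlice F x r‖ₑ ^ q) * ENNReal.ofReal (ψ r ^ (q - 2)) ≤
      ((C : ℝ≥0∞) ^ q * ENNReal.ofReal (N ^ (q / p - 1))) * B r := fun r hr => by
    have hr0 : 0 < r := hr.1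
    have hBp := ENNReal.toReal_pos hr.2 (hBt r)
    refine (mul_le_mul_left (lintegral_radialSlice_rpow_le hd hp hq0 hκ hpq hC hF hM hr0) _).trans
      (le_of_eq ?_)
    rw [← hBdef, mul_assoc, mul_assoc, mul_assoc]
    congr 1
    rw [← ENNReal.ofReal_toReal (hBt r), ENNReal.ofReal_rpow_of_pos hBp,
      ← ENNReal.ofReal_mul (by positivity), ← ENNReal.ofReal_mul (by positivity),
      ← ENNReal.ofReal_mul (by positivity)]
    congr 1
    have e1 : ψ r = r ^ α * (N / (B r).toReal) ^ (1 - α) := if_pos hr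
    have e2 : α * (q - 2) = κ := div_mul_cancel₀ _ (by linarith)
    have e3 : (1 - α) * (q - 2) = q / p - 1 := by rw [sub_mul, e2, hpq]; ring
    rw [e1, Real.mul_rpow (by positivity) (by positivity), ← Real.rpow_mul hr0.le,
      ← Real.rpow_mul (by positivity), e2, e3, Real.div_rpow hNp.le hBp.le,
      Real.rpow_sub_one hBp.ne', Real.rpow_neg hr0.le]
    have := (Real.rpow_pos_of_pos hr0 κ).ne'
    have := (Real.rpow_pos_of_pos hBp (q / p)).ne'
    field_simp
  calc ∫⁻ y, ‖hyperboloidExtension f y‖ₑ ^ q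
      = ∫⁻ x : Euc d, ∫⁻ t : ℝ, ‖hyperboloidExtension f (t, x)‖ₑ ^ q := by
        rw [Measure.volume_eq_prod, lintegral_prod_symm' _ hEm]
    _ ≤ ∫⁻ x : Euc d, P * ∫⁻ r in S, ‖radialSlice F x r‖ₑ ^ q * ENNReal.ofReal (ψ r ^ (q - 2))
          ∂hyperbolicRadialMeasure := lintegral_mono hslice
    _ = P * ∫⁻ r in S, (∫⁻ x, ‖radialSlice F x r‖ₑ ^ q) * ENNReal.ofReal (ψ r ^ (q - 2))
          ∂hyperbolicRadialMeasure := by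
        rw [lintegral_const_mul _ hkj.lintegral_prod_right', lintegral_lintegral_swap
          (f := fun x r => ‖radialSlice F x r‖ₑ ^ q * ENNReal.ofReal (ψ r ^ (q - 2)))
          hkj.aemeasurable]
        congr 1
        refine lintegral_congr fun r => ?_
        rw [lintegral_mul_const']
        exact ENNReal.ofReal_ne_top
    _ ≤ P * ∫⁻ r in S, ((C : ℝ≥0∞) ^ q * ENNReal.ofReal (N ^ (q / p - 1))) * B r
          ∂hyperbolicRadialMeasure :=
        mul_le_mul_right (setLIntegral_mono (by fun_prop) hweight) _
    _ ≤ P * (((C : ℝ≥0∞) ^ q * ENNReal.ofReal (N ^ (q / p - 1))) * ENNReal.ofReal N) := by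
        rw [lintegral_const_mul _ hBm, ← hBN]
        gcongr
        exact Measure.restrict_le_self
    _ = _ := by
        rw [ENNReal.ofReal_rpow_of_pos hNp, mul_assoc ((C : ℝ≥0∞) ^ q),
          ← ENNReal.ofReal_mul (by positivity), Real.rpow_sub_one hNp.ne',
          div_mul_cancel₀ _ hNp.ne', mul_assoc]

end MainEstimate

/-! ### From the a priori estimate to a bounded operator. -/

section Extension

variable {d : ℕ}

theorem isClosed_hyperboloid (d : ℕ) : IsClosed (hyperboloid d) :=
  isClosed_eq continuous_fst (continuous_bracket.comp continuous_snd)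

/-- For `p < ∞` the compactly supported continuous functions are dense in `L^p(Σ, μ)`, so the
operator defined on them extends by continuity. -/
theorem HyperboloidExtensionBounded.of_eLpNorm_le {p q : ℝ≥0∞} [Fact (1 ≤ p)] [Fact (1 ≤ q)]
    (hp : p ≠ ⊤) {C : ℝ≥0} (hC : ∀ f : hyperboloid d → ℂ, Continuous f → HasCompactSupport f →
      eLpNorm (hyperboloidExtension f) q volume ≤ C * eLpNorm f p (lorentzMeasure d)) :
    HyperboloidExtensionBounded d p q := by
  have : LocallyCompactSpace (hyperboloid d) := (isClosed_hyperboloid d).locallyCompactSpace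
  have hint : ∀ f : CompactlySupportedContinuousMap (hyperboloid d) ℂ,
      Integrable f (lorentzMeasure d) := fun f =>
    memLp_one_iff_integrable.1 (memLp_hyperboloid 1 f f.continuous f.hasCompactSupport)
  have hmem : ∀ f : CompactlySupportedContinuousMap (hyperboloid d) ℂ,
      MemLp (hyperboloidExtension f) q (volume : Measure (ℝ × Euc d)) := fun f =>
    ⟨(continuous_hyperboloidExtension (hint f)).aestronglyMeasurable,
      (hC f f.continuous f.hasCompactSupport).trans_lt (ENNReal.mul_lt_top ENNReal.coe_lt_top
        (memLp_hyperboloid p f f.continuous f.hasCompactSupport).2)⟩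
  let e : CompactlySupportedContinuousMap (hyperboloid d) ℂ →ₗ[ℂ] Lp ℂ p (lorentzMeasure d) :=
    { toFun := fun f => (memLp_hyperboloid p f f.continuous f.hasCompactSupport).toLp f
      map_add' := fun f g => rfl
      map_smul' := fun c f => rfl }
  let L : CompactlySupportedContinuousMap (hyperboloid d) ℂ →ₗ[ℂ]
      Lp ℂ q (volume : Measure (ℝ × Euc d)) :=
    { toFun := fun f => (hmem f).toLp _
      map_add' := fun f g => by
        rw [← MemLp.toLp_add]
        refine MemLp.toLp_congr _ _ (Filter.Eventually.of_forall fun y => ?_)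
        simp only [hyperboloidExtension, Pi.add_apply]
        rw [← integral_add (integrable_hyperboloidExtension (hint f) y)
          (integrable_hyperboloidExtension (hint g) y)]
        simp [mul_add]
      map_smul' := fun c f => by
        rw [RingHom.id_apply, ← MemLp.toLp_const_smul]
        refine MemLp.toLp_congr _ _ (Filter.Eventually.of_forall fun y => ?_)
        simp only [hyperboloidExtension, Pi.smul_apply, smul_eq_mul]
        rw [← integral_const_mul]
        simp [mul_left_comm] }
  have hdense : DenseRange e := by
    intro u
    rw [EMetric.mem_closure_iff]
    intro ε hε
    obtain ⟨δ, hδ0, hδ⟩ := exists_between hε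
    obtain ⟨g, hg1, hg2, hg3, -⟩ :=
      (Lp.memLp u).exists_hasCompactSupport_eLpNorm_sub_le hp hδ0.ne'
    refine ⟨_, ⟨⟨⟨g, hg3⟩, hg1⟩, rfl⟩, lt_of_le_of_lt ?_ hδ⟩
    have hgm := memLp_hyperboloid p g hg3 hg1
    change edist u (hgm.toLp g) ≤ δ
    rw [← Lp.toLp_coeFn u (Lp.memLp u), Lp.edist_toLp_toLp]
    exact hg2
  have hnorm : ∃ C : ℝ, ∀ f, ‖L f‖ ≤ C * ‖e f‖ := ⟨C, fun f => by
    have h := hC f f.continuous f.hasCompactSupport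
    have h' := ENNReal.toReal_mono (ENNReal.mul_ne_top ENNReal.coe_ne_top
        (memLp_hyperboloid p f f.continuous f.hasCompactSupport).2.ne) h
    rw [ENNReal.toReal_mul, ENNReal.coe_toReal] at h'
    change ‖(hmem f).toLp _‖ ≤
      C * ‖(memLp_hyperboloid p f f.continuous f.hasCompactSupport).toLp f‖
    rw [Lp.norm_toLp, Lp.norm_toLp]
    exact h'⟩
  refine ⟨L.extendOfNorm e, fun f hf hc => ?_⟩
  have h := LinearMap.extendOfNorm_eq (f := L) (e := e) hdense hnorm ⟨⟨f, hf⟩, hc⟩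
  change L.extendOfNorm e ((memLp_hyperboloid p f hf hc).toLp f) = (hmem ⟨⟨f, hf⟩, hc⟩).toLp _ at h
  rw [h]
  exact MemLp.coeFn_toLp _

theorem eLpNorm_top_hyperboloidExtension_le (f : hyperboloid d → ℂ) :
    eLpNorm (hyperboloidExtension f) ⊤ volume ≤ (1 : ℝ≥0) * eLpNorm f 1 (lorentzMeasure d) := by
  rw [eLpNorm_exponent_top, ENNReal.coe_one, one_mul, eLpNorm_one_eq_lintegral_enorm]
  refine essSup_le_of_ae_le _ (Filter.Eventually.of_forall fun y => ?_)
  refine (enorm_integral_le_lintegral_enorm _).trans (lintegral_mono fun z => ?_)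
  rw [enorm_mul, ← ofReal_norm (Complex.exp _), norm_cexp_I_mul_ofReal]
  simp

theorem exists_eLpNorm_hyperboloidExtension_le (hd : 2 ≤ d) {p q κ : ℝ} (hp : 0 < p) (hq : 2 < q)
    (hκ : κ = 2 / (d - 1)) (hκq : κ ≤ q - 2) (hpq : q / p = q - 1 - κ)
    (h : SphereExtensionBounded d (ENNReal.ofReal p) (ENNReal.ofReal q)) :
    ∃ C : ℝ≥0, ∀ f : hyperboloid d → ℂ, Continuous f → HasCompactSupport f →
      eLpNorm (hyperboloidExtension f) (ENNReal.ofReal q) volume ≤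
        C * eLpNorm f (ENNReal.ofReal p) (lorentzMeasure d) := by
  obtain ⟨C, hC⟩ := h
  have hq0 : 0 < q := by linarith
  set A := paleyConst q 2 (ENNReal.ofReal (2 * Real.pi)) * (C : ℝ≥0∞) ^ q with hA
  have hAt : A ^ (1 / q) ≠ ⊤ := by
    refine ENNReal.rpow_ne_top_of_nonneg (by positivity) (ENNReal.mul_ne_top
      (paleyConst_ne_top hq (by simp) ENNReal.ofReal_ne_top)
      (ENNReal.rpow_ne_top_of_nonneg hq0.le ENNReal.coe_ne_top))
  refine ⟨(A ^ (1 / q)).toNNReal, fun f hf hfc => ?_⟩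
  have h1 := ENNReal.rpow_le_rpow
    (lintegral_hyperboloidExtension_rpow_le hd hp hq hκ hκq hpq hC hf hfc)
    (show (0 : ℝ) ≤ 1 / q by positivity)
  rw [ENNReal.mul_rpow_of_nonneg _ _ (by positivity), ← ENNReal.rpow_mul,
    show q / p * (1 / q) = 1 / p by field_simp] at h1
  rw [ENNReal.coe_toNNReal hAt,
    eLpNorm_eq_lintegral_rpow_enorm_toReal (by simpa using hq0) ENNReal.ofReal_ne_top,
    eLpNorm_eq_lintegral_rpow_enorm_toReal (by simpa using hp) ENNReal.ofReal_ne_top,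
    ENNReal.toReal_ofReal hq0.le, ENNReal.toReal_ofReal hp.le]
  exact h1

end Extension

end

theorem proposition5p1 (d : ℕ) (hd : 2 ≤ d) (p p' q : ℝ≥0∞)
    [Fact (1 ≤ p)] [Fact (1 ≤ q)]
    (hpp' : ENNReal.HolderConjugate p p')
    (hq : p' = ((d : ℝ≥0∞) - 1) / ((d : ℝ≥0∞) + 1) * q)
    (hsphere : SphereExtensionBounded d p q) :
    HyperboloidExtensionBounded d p q := by
  have hd' : (2 : ℝ) ≤ d := by exact_mod_cast hd
  have hd1 : (0 : ℝ) < d - 1 := by linarith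
  have hratio : ((d : ℝ≥0∞) - 1) / ((d : ℝ≥0∞) + 1) =
      ENNReal.ofReal (((d : ℝ) - 1) / ((d : ℝ) + 1)) := by
    rw [ENNReal.ofReal_div_of_pos (by positivity), ENNReal.ofReal_sub _ zero_le_one,
      ENNReal.ofReal_add (by positivity) zero_le_one, ENNReal.ofReal_natCast, ENNReal.ofReal_one]
  have hratio0 : 0 < ((d : ℝ) - 1) / ((d : ℝ) + 1) := by positivity
  rw [hratio] at hq
  rcases eq_or_ne q ⊤ with rfl | hqt
  · rw [ENNReal.mul_top (ENNReal.ofReal_pos.2 hratio0).ne'] at hq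
    subst hq
    have hp1 : p = 1 := by
      have := ENNReal.holderConjugate_iff.1 hpp'
      simpa using this
    subst hp1
    exact .of_eLpNorm_le ENNReal.one_ne_top fun f _ _ => eLpNorm_top_hyperboloidExtension_le f
  have hq1 : 1 ≤ q.toReal := by
    rw [← ENNReal.toReal_one]
    exact ENNReal.toReal_mono hqt Fact.out
  have hqr : q = ENNReal.ofReal q.toReal := (ENNReal.ofReal_toReal hqt).symm
  set s := q.toReal with hs
  have hs0 : 0 < s := by linarith
  have hsd : 2 * (d : ℝ) / (d - 1) ≤ s := SphereExtensionBounded.le_exponent hd hq1 (hqr ▸ hsphere)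
  rw [hqr, ← ENNReal.ofReal_mul hratio0.le] at hq
  set p₁ := ((d : ℝ) - 1) / ((d : ℝ) + 1) * s with hp₁
  -- From `q ≥ 2d/(d-1)` one gets `p' ≥ 2d/(d+1) > 1`, which rules out `p = ∞`, where the density
  -- argument would fail.
  have hp₁1 : 1 < p₁ := by
    rw [div_le_iff₀ hd1] at hsd
    rw [hp₁, div_mul_eq_mul_div, lt_div_iff₀ (by positivity)]
    linarith
  have hinv := ENNReal.holderConjugate_iff.1 hpp'
  rw [hq] at hinv
  have hpt : p ≠ ⊤ := by
    rintro rfl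
    rw [ENNReal.inv_top, zero_add, ENNReal.inv_eq_one, ENNReal.ofReal_eq_one] at hinv
    linarith
  have hp0 : 0 < p.toReal := ENNReal.toReal_pos (one_pos.trans_le Fact.out).ne' hpt
  have hpr : p = ENNReal.ofReal p.toReal := (ENNReal.ofReal_toReal hpt).symm
  set t := p.toReal with ht
  have hreal : t⁻¹ + p₁⁻¹ = 1 := by
    rw [hpr, ← ENNReal.ofReal_inv_of_pos hp0, ← ENNReal.ofReal_inv_of_pos (by linarith),
      ← ENNReal.ofReal_add (by positivity) (by positivity), ENNReal.ofReal_eq_one] at hinv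
    exact hinv
  -- Since `2d/(d-1) = 2 + 2/(d-1)`, the necessary condition on `q` is exactly `α ≤ 1` for the
  -- weight.
  have hκq : 2 / ((d : ℝ) - 1) ≤ s - 2 := by
    have : 2 * (d : ℝ) / (d - 1) = 2 + 2 / (d - 1) := by field_simp; ring
    linarith
  have hpq : s / t = s - 1 - 2 / ((d : ℝ) - 1) := by
    have h1 : t⁻¹ = 1 - p₁⁻¹ := by linarith
    rw [div_eq_mul_inv, h1, hp₁]
    field_simp
    ring
  have hs2 : 2 < s := by
    have : 0 < 2 / ((d : ℝ) - 1) := by positivity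
    linarith
  obtain ⟨C, hC⟩ := exists_eLpNorm_hyperboloidExtension_le hd hp0 hs2 rfl hκq hpq
    (by rw [← hpr, ← hqr]; exact hsphere)
  rw [← hpr, ← hqr] at hC
  exact .of_eLpNorm_le hpt hC
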